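/- **Per-round circuit depth of the quantum amplitude-amplification eigensolver (QAAE).** A circuit is a sequence of layers, each consisting of arbitrary one- and two-qubit unitary gates acting on pairwise disjoint qubits; its depth is the number of layers. No work qubits are used. The register consists of one ancilla and $q\ge 1$ system qubits. Given an ansatz circuit $A$ on the system, of depth $D_A$, put $|\Psi\rangle=|+\rangle\otimes A|0\rangle^{\otimes q}$ and $R=1-2|\Psi\rangle\langle\Psi|$. Given a Hamiltonian $H$ on the system and a fixed $\omega\in\mathbb R$ put $$U=\sum_{k=0,1} i^k\,|k\rangle\langle k|\otimes e^{(-1)^k i\omega H}.$$ One QAAE round runs, on the input $|+\rangle\otimes|0\rangle^{\otimes q}$, the circuit of $A$ and then circuits for $U^\dagger$, $R$, $U$, $R$ in this temporal order, i.e. it applies $RURU^\dagger$ to $|\Psi\rangle$; here $U$ may be replaced by the unitary of any circuit that simulates it, and the circuit for $U^\dagger$ is the inverse of the one for $U$. Let $D_R$, $D_U$, $D_{\rm round}$ be the depths of the circuits used for $R$, for (the simulated) $U$, and for the whole round. 1. For all circuits for $A$, $R$, $U$, the round circuit produces this state and $D_{\rm round}\le D_A+2(D_R+D_U)$. 2.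 There are an absolute constant $C$ and, for every $q\ge1$, a circuit of depth at most $Cq$ on the $q+1$ qubits for the multi-controlled $Z$ gate (the diagonal gate that changes the sign of $|1\cdots1\rangle$ only), such that for every ansatz circuit $A$ the circuit $(\mathrm{Hadamard}\otimes A)\,R_0\,(\mathrm{Hadamard}\otimes A)^\dagger$, with $R_0=1-2|0\cdots0\rangle\langle0\cdots0|$ realized by this multi-controlled $Z$ conjugated by Pauli-$X$ gates on all qubits, implements $R$ exactly with depth $D_R\le 2D_A+Cq$. 3. Consequently there is an absolute constant $C'$ such that, with this reflection circuit, $D_{\rm round}\le 5D_A+2D_U+C'q$ for every $q\ge1$, every ansatz circuit $A$ and every circuit for $U$. 4. Let $\kappa\ge1$, $\omega\in\mathbb R$, and let $p$ be a polynomial. There is a polynomial $P$, depending only on $\kappa,\omega,p$, such that the following holds for every $q\ge1$, every Hamiltonian $H=\sum_{l=1}^{L}w_lP_l$ on $q$ qubits with $w_l\in\mathbb R$, distinct Pauli strings $P_l$ and $L\le p(q)$, all of whose eigenvalues lie in $(0,1]$, and every $\varepsilon_H\in(0,1]$. Let $S_{2\kappa}(t)$ be the Trotter–Suzuki product formula of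 order $2\kappa$ for $e^{itH}$ over the terms $h_l=w_lP_l$: $$S_2(t)=e^{ith_1/2}\cdots e^{ith_L/2}\,e^{ith_L/2}\cdots e^{ith_1/2},\qquad S_{2j}(t)=S_{2j-2}(p_jt)^2\,S_{2j-2}((1-4p_j)t)\,S_{2j-2}(p_jt)^2,$$ with $p_j=1/(4-4^{1/(2j-1)})$ for $j\ge2$. Then for some number of steps $\nu\ge1$ we have $\|S_{2\kappa}(-\omega/\nu)^\nu-e^{-i\omega H}\|\le\varepsilon_H$ in operator norm, and there is a circuit on the $q+1$ qubits that implements exactly $$\widetilde U=\sum_{k=0,1}i^k\,|k\rangle\langle k|\otimes S_{2\kappa}\big((-1)^k\omega/\nu\big)^\nu,$$ with $\|\widetilde U-U\|\le\varepsilon_H$ and depth $D_U\le P(q)\,\varepsilon_H^{-1/(2\kappa)}$. -/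

import Mathlib

open scoped Matrix Matrix.Norms.L2Operator

namespace QAAE

/-- Computational basis labels of an `n`-qubit register. -/
abbrev Basis (n : ℕ) := Fin n → Fin 2

/-- Operators on an `n`-qubit register.  The norm `‖M‖` is the operator norm with respect to the
Euclidean norm. -/
abbrev Op (n : ℕ) := Matrix (Basis n) (Basis n) ℂ

/-! ### Circuits and their depth -/

/-- An elementary gate: an arbitrary unitary on one qubit, or on two distinct qubits. -/
inductive Gate (n : ℕ) : Type
  | one (i : Fin n) (u : Matrix.unitaryGroup (Fin 2) ℂ) : Gate n
  | two (i j : Fin n) (hij : i ≠ j) (u : Matrix.unitaryGroup (Fin 2 × Fin 2) ℂ) : Gate n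

namespace Gate

/-- The qubits on which a gate acts. -/
def support {n : ℕ} : Gate n → Finset (Fin n)
  | one i _ => {i}
  | two i j _ _ => {i, j}

/-- The operator of a gate on the whole register (identity on the remaining qubits). -/
noncomputable def op {n : ℕ} : Gate n → Op n
  | one i u => Matrix.of fun x y =>
      if ∀ k, k ≠ i → x k = y k then (u : Matrix (Fin 2) (Fin 2) ℂ) (x i) (y i) else 0
  | two i j _ u => Matrix.of fun x y =>
      if ∀ k, k ≠ i → k ≠ j → x k = y k then
        (u : Matrix (Fin 2 × Fin 2) (Fin 2 × Fin 2) ℂ) (x i, x j) (y i, y j)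
      else 0

/-- The inverse gate. -/
noncomputable def adjoint {n : ℕ} : Gate n → Gate n
  | one i u => one i (star u)
  | two i j hij u => two i j hij (star u)

/-- The same gate on relabelled qubits. -/
def map {n m : ℕ} (f : Fin n ↪ Fin m) : Gate n → Gate m
  | one i u => one (f i) u
  | two i j hij u => two (f i) (f j) (fun h => hij (f.injective h)) u

theorem support_adjoint {n : ℕ} (g : Gate n) : g.adjoint.support = g.support := by
  cases g <;> rfl

theorem support_map {n m : ℕ} (f : Fin n ↪ Fin m) (g : Gate n) :
    (g.map f).support = g.support.map f := by
  cases g <;> simp [map, support]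

end Gate

/-- One time step: gates on pairwise disjoint sets of qubits, executed in parallel. -/
structure Layer (n : ℕ) where
  gates : List (Gate n)
  disjoint : gates.Pairwise fun g h => Disjoint g.support h.support

namespace Layer

/-- The operator of a layer; the factors commute, so their order is immaterial. -/
noncomputable def op {n : ℕ} (l : Layer n) : Op n := (l.gates.map Gate.op).prod

noncomputable def adjoint {n : ℕ} (l : Layer n) : Layer n where
  gates := l.gates.map Gate.adjoint
  disjoint := by
    rw [List.pairwise_map]
    simpa only [Gate.support_adjoint] using l.disjoint

def map {n m : ℕ} (f : Fin n ↪ Fin m) (l : Layer n) : Layer m where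
  gates := l.gates.map (Gate.map f)
  disjoint := by
    rw [List.pairwise_map]
    simpa only [Gate.support_map, Finset.disjoint_map] using l.disjoint

/-- A single one-qubit gate. -/
def single {n : ℕ} (i : Fin n) (u : Matrix.unitaryGroup (Fin 2) ℂ) : Layer n where
  gates := [Gate.one i u]
  disjoint := List.pairwise_singleton _ _

/-- The same one-qubit gate on every qubit. -/
def all (n : ℕ) (u : Matrix.unitaryGroup (Fin 2) ℂ) : Layer n where
  gates := (List.finRange n).map fun i => Gate.one i u
  disjoint := by
    rw [List.pairwise_map]
    refine (List.nodup_finRange n).imp ?_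
    intro a b hab
    simpa [Gate.support] using hab

end Layer

/-- A circuit without work qubits: a list of layers, the head of the list being executed first. -/
abbrev Circuit (n : ℕ) := List (Layer n)

namespace Circuit

/-- Number of time steps. -/
def depth {n : ℕ} (c : Circuit n) : ℕ := c.length

noncomputable def op {n : ℕ} (c : Circuit n) : Op n := (c.reverse.map Layer.op).prod

/-- The inverse circuit: inverse gates in reverse order. -/
noncomputable def adjoint {n : ℕ} (c : Circuit n) : Circuit n := c.reverse.map Layer.adjoint

/-- A circuit on the `q` system qubits as a circuit on ancilla and system;
the ancilla is qubit `0`. -/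
def onSystem {q : ℕ} (c : Circuit q) : Circuit (q + 1) :=
  c.map (Layer.map (Fin.succEmb q))

end Circuit

/-! ### States, tensor products with the ancilla, and the reflection -/

/-- The basis state `|0…0⟩`. -/
def ketZero (n : ℕ) : Basis n → ℂ := Pi.single 0 1

/-- The state `|+⟩ ⊗ φ` of ancilla and system. -/
noncomputable def plusTensor {q : ℕ} (φ : Basis q → ℂ) : Basis (q + 1) → ℂ :=
  fun x => ((1 / Real.sqrt 2 : ℝ) : ℂ) * φ (Fin.tail x)

/-- The operator `M ⊗ N`, with `M` on the ancilla and `N` on the system. -/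
def ancTensor {q : ℕ} (M : Matrix (Fin 2) (Fin 2) ℂ) (N : Op q) : Op (q + 1) :=
  Matrix.of fun x y => M (x 0) (y 0) * N (Fin.tail x) (Fin.tail y)

/-- The trial state `|Ψ⟩ = |+⟩ ⊗ A|0…0⟩`. -/
noncomputable def trialState {q : ℕ} (A : Circuit q) : Basis (q + 1) → ℂ :=
  plusTensor (A.op *ᵥ ketZero q)

/-- The Householder reflection `1 - 2|ψ⟩⟨ψ|`. -/
noncomputable def householder {n : ℕ} (ψ : Basis n → ℂ) : Op n :=
  1 - (2 : ℂ) • Matrix.vecMulVec ψ (star ψ)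

/-- The multi-controlled `Z` gate on `n` qubits: the sign flips exactly on `|1…1⟩`. -/
def multiControlledZ (n : ℕ) : Op n :=
  Matrix.diagonal fun x => if ∀ i, x i = 1 then -1 else 1

/-- The Hadamard gate. -/
noncomputable def hadamard : Matrix.unitaryGroup (Fin 2) ℂ :=
  ⟨((1 / Real.sqrt 2 : ℝ) : ℂ) • !![1, 1; 1, -1], by
    have h : ((Real.sqrt 2 : ℝ) : ℂ) * ((Real.sqrt 2 : ℝ) : ℂ) = 2 := by
      rw [← Complex.ofReal_mul, Real.mul_self_sqrt (by norm_num)]; norm_num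
    have h' : ((Real.sqrt 2 : ℝ) : ℂ)⁻¹ * ((Real.sqrt 2 : ℝ) : ℂ)⁻¹ = 1 / 2 := by
      rw [← mul_inv, h]; norm_num
    rw [Matrix.mem_unitaryGroup_iff]
    ext i j
    fin_cases i <;> fin_cases j <;>
      simp [Matrix.mul_apply, Fin.sum_univ_two, Matrix.star_apply, h'] <;> norm_num⟩

/-- The Pauli `X` gate. -/
def pauliX : Matrix.unitaryGroup (Fin 2) ℂ :=
  ⟨!![0, 1; 1, 0], by
    rw [Matrix.mem_unitaryGroup_iff]
    ext i j
    fin_cases i <;> fin_cases j <;>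
      simp [Matrix.mul_apply, Fin.sum_univ_two, Matrix.star_apply]⟩

/-- The canonical reflection circuit for `(Hadamard ⊗ A) R₀ (Hadamard ⊗ A)†`, where
`R₀ = 1 - 2|0…0⟩⟨0…0|` is the circuit `Z` (a multi-controlled `Z`) conjugated by `X` on all
qubits. -/
noncomputable def reflectionCircuit {q : ℕ} (A : Circuit q) (Z : Circuit (q + 1)) :
    Circuit (q + 1) :=
  A.onSystem.adjoint ++ [Layer.single 0 hadamard] ++ [Layer.all (q + 1) pauliX] ++ Z ++
    [Layer.all (q + 1) pauliX] ++ [Layer.single 0 hadamard] ++ A.onSystem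

/-- The circuit of one round: state preparation `A`, then `U†`, `R`, `U`, `R` in this temporal
order.  It is run on the input `|+⟩ ⊗ |0…0⟩`. -/
noncomputable def roundCircuit {q : ℕ} (A : Circuit q) (R U : Circuit (q + 1)) :
    Circuit (q + 1) :=
  A.onSystem ++ U.adjoint ++ R ++ U ++ R

/-! ### Hamiltonians, controlled evolution, product formulas -/

/-- The Pauli matrices `σ₀ = 1, σ₁ = X, σ₂ = Y, σ₃ = Z`. -/
def pauli : Fin 4 → Matrix (Fin 2) (Fin 2) ℂ :=
  ![1, !![0, 1; 1, 0], !![0, -Complex.I; Complex.I, 0], !![1, 0; 0, -1]]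

/-- The Pauli string `σ_{v₁} ⊗ ⋯ ⊗ σ_{v_q}`. -/
def pauliString {q : ℕ} (v : Fin q → Fin 4) : Op q :=
  Matrix.of fun x y => ∏ j, pauli (v j) (x j) (y j)

/-- The terms `h_l = w_l P_l` of a Hamiltonian. -/
def pauliTerm {q L : ℕ} (w : Fin L → ℝ) (v : Fin L → Fin q → Fin 4) (l : Fin L) : Op q :=
  ((w l : ℝ) : ℂ) • pauliString (v l)

/-- Normalized Hamiltonian: all eigenvalues lie in `(0, 1]`. -/
def IsNormalized {q : ℕ} (H : Op q) : Prop :=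
  H.IsHermitian ∧ ∀ μ ∈ spectrum ℝ H, 0 < μ ∧ μ ≤ 1

/-- `∑ₖ iᵏ |k⟩⟨k| ⊗ W k`. -/
noncomputable def controlled {q : ℕ} (W : Fin 2 → Op q) : Op (q + 1) :=
  ∑ k : Fin 2, Complex.I ^ (k : ℕ) • ancTensor (Matrix.single k k 1) (W k)

/-- `e^{i t H}`. -/
noncomputable def evolution {q : ℕ} (H : Op q) (t : ℝ) : Op q :=
  NormedSpace.exp ((Complex.I * (t : ℂ)) • H)

/-- `U = ∑ₖ iᵏ |k⟩⟨k| ⊗ e^{(-1)ᵏ i ω H}`. -/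
noncomputable def controlledEvolution {q : ℕ} (H : Op q) (ω : ℝ) : Op (q + 1) :=
  controlled fun k => evolution H ((-1) ^ (k : ℕ) * ω)

/-- The symmetric second-order product formula
`e^{ith₁/2} ⋯ e^{ith_L/2} e^{ith_L/2} ⋯ e^{ith₁/2}`. -/
noncomputable def strang {q L : ℕ} (h : Fin L → Op q) (t : ℝ) : Op q :=
  (List.ofFn fun l => evolution (h l) (t / 2)).prod *
    (List.ofFn fun l => evolution (h l) (t / 2)).reverse.prod

/-- The Trotter–Suzuki product formula `S_{2κ}(t)` of order `2κ`, for `κ ≥ 1`: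
`S_{2κ}(t) = S_{2κ-2}(p t)² S_{2κ-2}((1 - 4p) t) S_{2κ-2}(p t)²` with
`p = 1 / (4 - 4^{1/(2κ-1)})`. The value at `κ = 0` is a placeholder. -/
noncomputable def suzuki {q L : ℕ} (h : Fin L → Op q) : ℕ → ℝ → Op q
  | 0, _ => 1
  | 1, t => strang h t
  | k + 2, t =>
      let p : ℝ := 1 / (4 - (4 : ℝ) ^ (1 / (2 * (k + 2 : ℝ) - 1)))
      suzuki h (k + 1) (p * t) ^ 2 * suzuki h (k + 1) ((1 - 4 * p) * t) *
        suzuki h (k + 1) (p * t) ^ 2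

/-- `ν` equal steps of the product formula for the total time `t`. -/
noncomputable def trotter {q L : ℕ} (h : Fin L → Op q) (κ ν : ℕ) (t : ℝ) : Op q :=
  suzuki h κ (t / ν) ^ ν

/-- The controlled evolution `U` with each exponential replaced by its product formula. -/
noncomputable def controlledTrotter {q L : ℕ} (h : Fin L → Op q) (κ ν : ℕ) (ω : ℝ) :
    Op (q + 1) :=
  controlled fun k => trotter h κ ν ((-1) ^ (k : ℕ) * ω)

end QAAE

namespace QAAE

/-! The round identity and its depth are bookkeeping: operators of concatenated circuits multiply in
reverse order, depths add, and the inverse circuit has the adjoint operator because disjoint gates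
in a layer commute.

For the reflection, a unitary conjugate of a Householder reflection is the reflection in the image
vector (`householder_conj`), and the multi-controlled `Z` is the reflection in `|1…1⟩`. It therefore
suffices that `X` on all qubits, then the Hadamard gate, then `A` carry `|1…1⟩` to the trial state.

The multi-controlled `Z` in linear depth without work qubits comes from incrementers. Adding one to
`q + 1` bits and then subtracting one from the last `q` flips the leading bit exactly when all the
others are `1`; a Hadamard gate on either side turns this into a `Z`. The increment is diagonal in
the Fourier basis, with a product of one-qubit phases as its diagonal, so it has linear depth once
the Fourier transform has. The Fourier transform does, because the controlled phases on pairs `j <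
k` with a fixed sum `j + k` are disjoint and respect the order of the usual circuit
(`op_fourierCircuit_apply`).

For the simulation, the two branches of `U` differ by the sign of time, so the controlled
exponential of a Pauli term is the single rotation `e^{iθ Z ⊗ P}`. It is a one-qubit `Z` rotation of
the ancilla conjugated by `q` two-qubit gates (`flipCircuit_conj_pauli`); no further control is
needed.

The order of the Suzuki formula is proved with entire functions. `ApproxExp` records an error `zⁿ
g(z)` together with `g(0)`. These leading coefficients add under products and scale by `cⁿ` under `z
↦ cz`, so Suzuki's coefficient cancels them, while palindromic symmetry removes even orders
(`approxExp_suzuki`). The maximum principle turns the order into an explicit bound. The weights are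
at most `1`, as normalized traces of `P_l H`, and telescoping over the `ν` unitary steps gives the
final error. -/

/-! ### Gates, layers and circuits as operators -/

/-- `M` acts as the identity outside the qubits `S`. -/
def ActsOn {n : ℕ} (S : Finset (Fin n)) (M : Op n) : Prop :=
  (∀ x y, ∀ k ∉ S, x k ≠ y k → M x y = 0) ∧
    ∀ x y x' y', (∀ k ∉ S, x k = y k) → (∀ k ∉ S, x' k = y' k) →
      (∀ k ∈ S, x k = x' k) → (∀ k ∈ S, y k = y' k) → M x y = M x' y'

/-- A nonzero summand forces the intermediate label to equal `x` off `S` and `y` off `T`, hence `y`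
on `S`; only one label is left. -/
theorem ActsOn.mul_apply {n : ℕ} {S T : Finset (Fin n)} {M N : Op n} (hM : ActsOn S M)
    (hN : ActsOn T N) (h : Disjoint S T) (x y : Basis n) :
    (M * N) x y = M x (S.piecewise y x) * N (S.piecewise y x) y := by
  rw [Matrix.mul_apply]
  refine Finset.sum_eq_single _ (fun z _ hz => ?_) (by simp)
  by_contra hne
  obtain ⟨h1, h2⟩ := mul_ne_zero_iff.1 hne
  refine hz (funext fun k => ?_)
  by_cases hk : k ∈ S
  · rw [Finset.piecewise_eq_of_mem _ _ _ hk]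
    by_contra hc
    exact h2 (hN.1 _ _ k (Finset.disjoint_left.1 h hk) hc)
  · rw [Finset.piecewise_eq_of_notMem _ _ _ hk]
    by_contra hc
    exact h1 (hM.1 _ _ k hk (Ne.symm hc))

/-- Both products collapse to one summand. The factors agree because each depends only on the
coordinates in its own set; if `x` and `y` differ outside both sets, both products vanish. -/
theorem ActsOn.commute {n : ℕ} {S T : Finset (Fin n)} {M N : Op n} (hM : ActsOn S M)
    (hN : ActsOn T N) (h : Disjoint S T) : Commute M N := by
  have hl : ∀ k ∈ S, k ∉ T := fun _ hk => Finset.disjoint_left.1 h hk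
  ext x y
  rw [hM.mul_apply hN h, hN.mul_apply hM h.symm, mul_comm (N _ _)]
  by_cases hxy : ∀ k, k ∉ S → k ∉ T → x k = y k
  · congr 1
    · refine hM.2 _ _ _ _ ?_ ?_ ?_ ?_ <;> intro k hk
      · simp [hk]
      · by_cases hT : k ∈ T <;> simp [hT, hxy k hk]
      · simp [hl k hk]
      · simp [hk]
    · refine hN.2 _ _ _ _ ?_ ?_ ?_ ?_ <;> intro k hk
      · by_cases hS : k ∈ S <;> simp [hS]
        exact hxy k hS hk
      · simp [hk]
      · have : k ∉ S := fun hS => hl k hS hk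
        simp [this]
      · simp [hk]
  · push Not at hxy
    obtain ⟨k, hS, hT, hne⟩ := hxy
    rw [hN.1 _ y k hT (by simpa [hS] using hne), hM.1 _ y k hS (by simpa [hT] using hne)]
    simp

theorem Gate.actsOn {n : ℕ} (g : Gate n) : ActsOn g.support g.op := by
  cases g with
  | one i u =>
    refine ⟨fun x y k hk hne => ?_, fun x y x' y' h1 h2 h3 h4 => ?_⟩
    · simp only [Gate.support, Finset.mem_singleton] at hk
      simp only [Gate.op, Matrix.of_apply]
      exact if_neg fun h => hne (h k hk)
    · simp only [Gate.support, Finset.mem_singleton] at h1 h2 h3 h4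
      simp only [Gate.op, Matrix.of_apply]
      rw [if_pos h1, if_pos h2, h3 i rfl, h4 i rfl]
  | two i j hij u =>
    refine ⟨fun x y k hk hne => ?_, fun x y x' y' h1 h2 h3 h4 => ?_⟩
    · simp only [Gate.support, Finset.mem_insert, Finset.mem_singleton, not_or] at hk
      simp only [Gate.op, Matrix.of_apply]
      exact if_neg fun h => hne (h k hk.1 hk.2)
    · simp only [Gate.support, Finset.mem_insert, Finset.mem_singleton, not_or, and_imp] at h1 h2 h3 h4
      simp only [Gate.op, Matrix.of_apply]
      rw [if_pos h1, if_pos h2, h3 i (.inl rfl), h4 i (.inl rfl), h3 j (.inr rfl), h4 j (.inr rfl)]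

theorem Gate.commute {n : ℕ} {g h : Gate n} (hd : Disjoint g.support h.support) :
    Commute g.op h.op := g.actsOn.commute h.actsOn hd

theorem Gate.op_adjoint {n : ℕ} (g : Gate n) : g.adjoint.op = g.opᴴ := by
  cases g with
  | one i u =>
    ext x y
    simp only [Gate.adjoint, Gate.op, Matrix.of_apply, Matrix.conjTranspose_apply, eq_comm (a := x _)]
    split_ifs <;> simp [Matrix.star_apply]
  | two i j hij u =>
    ext x y
    simp only [Gate.adjoint, Gate.op, Matrix.of_apply, Matrix.conjTranspose_apply, eq_comm (a := x _)]
    split_ifs <;> simp [Matrix.star_apply]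

theorem sum_agree_off_one {n : ℕ} (i : Fin n) (x : Basis n) (f : Basis n → ℂ) :
    ∑ z, (if ∀ k, k ≠ i → x k = z k then f z else 0) = ∑ b, f (Function.update x i b) := by
  rw [← Finset.sum_filter]
  symm
  refine Finset.sum_bij' (fun b _ => Function.update x i b) (fun z _ => z i) ?_ ?_ ?_ ?_ ?_
  · intro b _
    simp only [Finset.mem_filter, Finset.mem_univ, true_and]
    intro k hk
    simp [hk]
  · simp
  · simp
  · intro z hz
    simp only [Finset.mem_filter, Finset.mem_univ, true_and] at hz
    funext k
    by_cases hk : k = i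
    · subst hk; simp
    · simp [hk, hz k hk]
  · simp

theorem sum_agree_off_two {n : ℕ} {i j : Fin n} (hij : i ≠ j) (x : Basis n) (f : Basis n → ℂ) :
    ∑ z, (if ∀ k, k ≠ i → k ≠ j → x k = z k then f z else 0) =
      ∑ b : Fin 2 × Fin 2, f (Function.update (Function.update x i b.1) j b.2) := by
  rw [← Finset.sum_filter]
  symm
  refine Finset.sum_bij' (fun b _ => Function.update (Function.update x i b.1) j b.2)
    (fun z _ => (z i, z j)) ?_ ?_ ?_ ?_ ?_
  · intro b _
    simp only [Finset.mem_filter, Finset.mem_univ, true_and]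
    intro k hk hk'
    simp [hk, hk']
  · simp
  · simp [hij]
  · intro z hz
    simp only [Finset.mem_filter, Finset.mem_univ, true_and] at hz
    funext k
    by_cases hk : k = i
    · subst hk; simp [hij]
    · by_cases hk' : k = j
      · subst hk'; simp
      · simp [hk, hk', hz k hk hk']
  · simp

theorem Gate.op_mul_conjTranspose {n : ℕ} (g : Gate n) : g.op * g.opᴴ = 1 := by
  cases g with
  | one i u =>
    have hu := congrFun₂ (Matrix.mem_unitaryGroup_iff.1 u.2)
    ext x y
    simp only [Matrix.mul_apply, Matrix.star_apply] at hu
    simp only [Gate.op, Matrix.mul_apply, Matrix.of_apply, Matrix.conjTranspose_apply, ite_mul,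
      zero_mul]
    rw [sum_agree_off_one i x]
    by_cases h : ∀ k, k ≠ i → y k = x k
    · have h' : ∀ b, (∀ k, k ≠ i → y k = Function.update x i b k) := fun b k hk => by
        simp [hk, h k hk]
      simp only [Function.update_self, if_pos (h' _)]
      rw [hu, Matrix.one_apply, Matrix.one_apply]
      congr 1
      exact propext ⟨fun e => funext fun k => if hk : k = i then hk ▸ e else (h k hk).symm,
        fun e => congrFun e i⟩
    · have h' : ∀ b, ¬ (∀ k, k ≠ i → y k = Function.update x i b k) := fun b hb => h fun k hk => by
        simpa [hk] using hb k hk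
      simp only [h', if_false, star_zero, mul_zero, Finset.sum_const_zero]
      rw [Matrix.one_apply_ne]
      rintro rfl
      exact h fun _ _ => rfl
  | two i j hij u =>
    have hu := congrFun₂ (Matrix.mem_unitaryGroup_iff.1 u.2)
    ext x y
    simp only [Matrix.mul_apply, Matrix.star_apply] at hu
    simp only [Gate.op, Matrix.mul_apply, Matrix.of_apply, Matrix.conjTranspose_apply, ite_mul,
      zero_mul]
    rw [sum_agree_off_two hij x]
    by_cases h : ∀ k, k ≠ i → k ≠ j → y k = x k
    · have h' : ∀ b : Fin 2 × Fin 2, (∀ k, k ≠ i → k ≠ j →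
          y k = Function.update (Function.update x i b.1) j b.2 k) := fun b k hk hk' => by
        simp [hk, hk', h k hk hk']
      simp only [Function.update_self, Function.update_of_ne hij, if_pos (h' _)]
      rw [hu, Matrix.one_apply, Matrix.one_apply]
      congr 1
      refine propext ⟨fun e => funext fun k => ?_, fun e => e ▸ rfl⟩
      by_cases hk : k = i
      · exact hk ▸ (Prod.mk.inj e).1
      · by_cases hk' : k = j
        · exact hk' ▸ (Prod.mk.inj e).2
        · exact (h k hk hk').symm
    · have h' : ∀ b : Fin 2 × Fin 2, ¬ (∀ k, k ≠ i → k ≠ j →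
          y k = Function.update (Function.update x i b.1) j b.2 k) := fun b hb =>
        h fun k hk hk' => by simpa [hk, hk'] using hb k hk hk'
      simp only [h', if_false, star_zero, mul_zero, Finset.sum_const_zero]
      rw [Matrix.one_apply_ne]
      rintro rfl
      exact h fun _ _ _ => rfl

theorem Gate.op_mem_unitary {n : ℕ} (g : Gate n) : g.op ∈ unitary (Op n) :=
  Matrix.mem_unitaryGroup_iff.2 g.op_mul_conjTranspose

/-- The adjoint reverses the order of the factors; disjoint gates commute, so the order can be
restored. -/
theorem Layer.op_adjoint {n : ℕ} (l : Layer n) : l.adjoint.op = l.opᴴ := by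
  unfold Layer.op Layer.adjoint
  rw [Matrix.conjTranspose_list_prod]
  simp only [List.map_map]
  have : Matrix.conjTranspose ∘ Gate.op = (Gate.op ∘ Gate.adjoint : Gate n → Op n) := by
    funext g; simp [Gate.op_adjoint]
  rw [this]
  refine (List.Perm.prod_eq' (List.reverse_perm _).symm ?_)
  rw [List.pairwise_map]
  refine l.disjoint.imp fun {a b} hab => Gate.commute ?_
  simpa only [Gate.support_adjoint] using hab

theorem Layer.op_mem_unitary {n : ℕ} (l : Layer n) : l.op ∈ unitary (Op n) := by
  refine Submonoid.list_prod_mem _ ?_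
  simp only [List.mem_map]
  rintro _ ⟨g, _, rfl⟩
  exact g.op_mem_unitary

namespace Circuit

@[simp] theorem op_nil {n : ℕ} : Circuit.op ([] : Circuit n) = 1 := rfl

theorem op_append {n : ℕ} (c d : Circuit n) : Circuit.op (c ++ d) = d.op * c.op := by
  simp [Circuit.op]

@[simp] theorem op_singleton {n : ℕ} (l : Layer n) : Circuit.op [l] = l.op := by
  simp [Circuit.op]

theorem op_cons {n : ℕ} (l : Layer n) (c : Circuit n) : Circuit.op (l :: c) = c.op * l.op := by
  simp [Circuit.op]

theorem op_adjoint {n : ℕ} (c : Circuit n) : c.adjoint.op = c.opᴴ := by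
  unfold Circuit.op Circuit.adjoint
  rw [Matrix.conjTranspose_list_prod, ← List.map_reverse, ← List.map_reverse, List.reverse_reverse]
  simp only [List.map_map, List.map_reverse, List.reverse_reverse]
  congr 2
  funext l
  simp [Layer.op_adjoint]

theorem op_mem_unitary {n : ℕ} (c : Circuit n) : c.op ∈ unitary (Op n) := by
  refine Submonoid.list_prod_mem _ ?_
  simp only [List.mem_map]
  rintro _ ⟨g, _, rfl⟩
  exact g.op_mem_unitary

theorem conjTranspose_mul_op {n : ℕ} (c : Circuit n) : c.opᴴ * c.op = 1 :=
  Matrix.mem_unitaryGroup_iff'.1 c.op_mem_unitary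

@[simp] theorem depth_append {n : ℕ} (c d : Circuit n) :
    Circuit.depth (c ++ d) = c.depth + d.depth := by simp [Circuit.depth]

@[simp] theorem depth_cons {n : ℕ} (l : Layer n) (c : Circuit n) :
    Circuit.depth (l :: c) = c.depth + 1 := by simp [Circuit.depth]

@[simp] theorem depth_nil {n : ℕ} : Circuit.depth ([] : Circuit n) = 0 := rfl

@[simp] theorem depth_adjoint {n : ℕ} (c : Circuit n) : c.adjoint.depth = c.depth := by
  simp [Circuit.depth, Circuit.adjoint]

@[simp] theorem depth_onSystem {n : ℕ} (c : Circuit n) : c.onSystem.depth = c.depth := by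
  simp [Circuit.depth, Circuit.onSystem]

end Circuit

/-! ### Tensor products with the ancilla -/

theorem sum_basis_succ {q : ℕ} {M : Type*} [AddCommMonoid M] (f : Basis (q + 1) → M) :
    ∑ z, f z = ∑ a : Fin 2, ∑ z : Basis q, f (Fin.cons a z) := by
  rw [← (Fin.consEquiv fun _ => Fin 2).sum_comp, Fintype.sum_prod_type]
  rfl

theorem ancTensor_mul {q : ℕ} (M M' : Matrix (Fin 2) (Fin 2) ℂ) (N N' : Op q) :
    ancTensor M N * ancTensor M' N' = ancTensor (M * M') (N * N') := by
  ext x y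
  simp only [ancTensor, Matrix.mul_apply, Matrix.of_apply, sum_basis_succ, Fin.cons_zero,
    Fin.tail_cons, Finset.sum_mul_sum]
  refine Finset.sum_congr rfl fun a _ => Finset.sum_congr rfl fun z _ => ?_
  ring

theorem basis_succ_ext {q : ℕ} {x y : Basis (q + 1)} :
    x = y ↔ x 0 = y 0 ∧ Fin.tail x = Fin.tail y := by
  refine ⟨fun h => h ▸ ⟨rfl, rfl⟩, fun h => ?_⟩
  rw [← Fin.cons_self_tail x, h.1, h.2, Fin.cons_self_tail]

@[simp] theorem ancTensor_one_one {q : ℕ} : ancTensor 1 (1 : Op q) = 1 := by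
  ext x y
  simp only [ancTensor, Matrix.of_apply, Matrix.one_apply, basis_succ_ext]
  split_ifs <;> simp_all

theorem ancTensor_conjTranspose {q : ℕ} (M : Matrix (Fin 2) (Fin 2) ℂ) (N : Op q) :
    (ancTensor M N)ᴴ = ancTensor Mᴴ Nᴴ := by
  ext x y
  simp [ancTensor, Matrix.conjTranspose_apply]

theorem ancTensor_add_right {q : ℕ} (M : Matrix (Fin 2) (Fin 2) ℂ) (N N' : Op q) :
    ancTensor M (N + N') = ancTensor M N + ancTensor M N' := by
  ext x y
  simp [ancTensor, mul_add]

theorem ancTensor_sub_right {q : ℕ} (M : Matrix (Fin 2) (Fin 2) ℂ) (N N' : Op q) :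
    ancTensor M (N - N') = ancTensor M N - ancTensor M N' := by
  ext x y
  simp [ancTensor, mul_sub]

theorem ancTensor_smul_right {q : ℕ} (c : ℂ) (M : Matrix (Fin 2) (Fin 2) ℂ) (N : Op q) :
    ancTensor M (c • N) = c • ancTensor M N := by
  ext x y
  simp [ancTensor]
  ring

theorem Gate.op_map_succ {q : ℕ} (g : Gate q) :
    (g.map (Fin.succEmb q)).op = ancTensor 1 g.op := by
  cases g with
  | one i u =>
    ext x y
    simp only [Gate.map, Gate.op, ancTensor, Matrix.of_apply, Fin.forall_fin_succ, Matrix.one_apply,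
      Fin.coe_succEmb, Fin.tail, ne_eq, Fin.succ_inj, (Fin.succ_ne_zero _).symm, not_false_iff,
      forall_true_left, ite_mul, one_mul, zero_mul, ite_and]
    congr
  | two i j hij u =>
    ext x y
    simp only [Gate.map, Gate.op, ancTensor, Matrix.of_apply, Fin.forall_fin_succ, Matrix.one_apply,
      Fin.coe_succEmb, Fin.tail, ne_eq, Fin.succ_inj, (Fin.succ_ne_zero _).symm, not_false_iff,
      forall_true_left, ite_mul, one_mul, zero_mul, ite_and]
    congr

theorem ancTensor_one_list_prod {q : ℕ} (l : List (Op q)) :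
    (l.map (ancTensor 1)).prod = ancTensor 1 l.prod := by
  induction l with
  | nil => simp
  | cons a l ih => simp [ih, ancTensor_mul]

theorem Circuit.op_onSystem {q : ℕ} (c : Circuit q) : c.onSystem.op = ancTensor 1 c.op := by
  have hl : ∀ l : Layer q, (l.map (Fin.succEmb q)).op = ancTensor 1 l.op := fun l => by
    simp only [Layer.op, Layer.map, ← ancTensor_one_list_prod, List.map_map]
    congr 2
    funext g
    exact g.op_map_succ
  simp only [Circuit.op, Circuit.onSystem, ← ancTensor_one_list_prod, ← List.map_reverse,
    List.map_map]
  congr 2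
  funext l
  exact hl l

theorem Gate.op_one_zero {q : ℕ} (u : Matrix.unitaryGroup (Fin 2) ℂ) :
    (Gate.one (0 : Fin (q + 1)) u).op = ancTensor (u : Matrix (Fin 2) (Fin 2) ℂ) 1 := by
  ext x y
  have : (∀ k, k ≠ 0 → x k = y k) ↔ Fin.tail x = Fin.tail y := by
    rw [funext_iff, Fin.forall_fin_succ]
    simp [Fin.tail]
  simp only [Gate.op, ancTensor, Matrix.of_apply, this, Matrix.one_apply]
  split_ifs <;> simp

theorem Layer.op_single_zero {q : ℕ} (u : Matrix.unitaryGroup (Fin 2) ℂ) :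
    (Layer.single (0 : Fin (q + 1)) u).op = ancTensor (u : Matrix (Fin 2) (Fin 2) ℂ) 1 := by
  simp [Layer.op, Layer.single, Gate.op_one_zero]

/-! ### Product operators -/

/-- The operator `M₀ ⊗ ⋯ ⊗ M_{n-1}`. -/
def piTensor {n : ℕ} : (Fin n → Matrix (Fin 2) (Fin 2) ℂ) →* Op n where
  toFun M := Matrix.of fun x y => ∏ j, M j (x j) (y j)
  map_one' := by
    ext x y
    simp only [Matrix.of_apply, Pi.one_apply, Matrix.one_apply, Finset.prod_ite_zero, funext_iff]
    simp
  map_mul' M N := by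
    ext x y
    simp only [Matrix.of_apply, Pi.mul_apply, Matrix.mul_apply, ← Finset.prod_mul_distrib]
    rw [Finset.prod_univ_sum]
    simp

theorem piTensor_apply {n : ℕ} (M : Fin n → Matrix (Fin 2) (Fin 2) ℂ) (x y : Basis n) :
    piTensor M x y = ∏ j, M j (x j) (y j) := rfl

theorem piTensor_mulSingle_apply {n : ℕ} (i : Fin n) (u : Matrix (Fin 2) (Fin 2) ℂ)
    (x y : Basis n) : piTensor (Pi.mulSingle i u) x y =
      if ∀ k, k ≠ i → x k = y k then u (x i) (y i) else 0 := by
  rw [piTensor_apply, ← Finset.mul_prod_erase _ _ (Finset.mem_univ i), Pi.mulSingle_eq_same]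
  have : ∏ k ∈ Finset.univ.erase i, (Pi.mulSingle i u : Fin n → Matrix (Fin 2) (Fin 2) ℂ) k (x k) (y k) =
      ∏ k ∈ Finset.univ.erase i, if x k = y k then 1 else 0 := by
    refine Finset.prod_congr rfl fun k hk => ?_
    rw [Pi.mulSingle_eq_of_ne (Finset.ne_of_mem_erase hk), Matrix.one_apply]
  rw [this, Finset.prod_ite_zero]
  simp

theorem Gate.op_one {n : ℕ} (i : Fin n) (u : Matrix.unitaryGroup (Fin 2) ℂ) :
    (Gate.one i u).op = piTensor (Pi.mulSingle i (u : Matrix (Fin 2) (Fin 2) ℂ)) := by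
  ext x y
  rw [piTensor_mulSingle_apply]
  rfl

theorem list_prod_mulSingle {n : ℕ} {M : Type*} [Monoid M] (u : Fin n → M) :
    ((List.finRange n).map fun i => (Pi.mulSingle i (u i) : Fin n → M)).prod = u := by
  funext j
  rw [Pi.list_prod_apply, List.map_map]
  have key : ∀ l : List (Fin n), l.Nodup →
      (l.map ((fun f : Fin n → M => f j) ∘ fun i => Pi.mulSingle i (u i))).prod =
        if j ∈ l then u j else 1 := by
    intro l hl
    induction l with
    | nil => simp
    | cons a l ih =>
      rw [List.map_cons, List.prod_cons, ih hl.of_cons]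
      by_cases h : j = a
      · subst h
        simp [(List.nodup_cons.1 hl).1]
      · simp [h]
  rw [key _ (List.nodup_finRange n)]
  simp

theorem Layer.op_all {n : ℕ} (u : Matrix.unitaryGroup (Fin 2) ℂ) :
    (Layer.all n u).op = piTensor fun _ => (u : Matrix (Fin 2) (Fin 2) ℂ) := by
  simp only [Layer.op, Layer.all, List.map_map]
  rw [show Gate.op ∘ (fun i : Fin n => Gate.one i u) =
    piTensor ∘ fun i => Pi.mulSingle i (u : Matrix (Fin 2) (Fin 2) ℂ) from
      funext fun i => Gate.op_one i u, ← List.map_map, ← map_list_prod, list_prod_mulSingle]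

/-! ### The reflection and the round -/

theorem householder_conj {n : ℕ} {V : Op n} (hV : V * Vᴴ = 1) (ψ : Basis n → ℂ) :
    V * householder ψ * Vᴴ = householder (V *ᵥ ψ) := by
  unfold householder
  rw [mul_sub, sub_mul, mul_one, hV, Matrix.mul_smul, Matrix.smul_mul, Matrix.mul_vecMulVec,
    Matrix.vecMulVec_mul, Matrix.star_mulVec]

/-- The basis state `|1…1⟩`. -/
def ketOne (n : ℕ) : Basis n → ℂ := Pi.single 1 1

theorem multiControlledZ_eq_householder (n : ℕ) :
    multiControlledZ n = householder (ketOne n) := by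
  ext x y
  have h1 : (∀ i, x i = 1) ↔ x = 1 := by simp [funext_iff]
  simp only [multiControlledZ, householder, ketOne, Matrix.sub_apply, Matrix.smul_apply,
    Matrix.vecMulVec_apply, Matrix.diagonal_apply, Matrix.one_apply, Pi.star_apply, Pi.single_apply,
    h1]
  by_cases hxy : x = y
  · subst hxy
    by_cases hx : x = 1
    · simp [hx]; norm_num
    · simp [hx]
  · by_cases hx : x = 1
    · subst hx
      simp [hxy, Ne.symm hxy]
    · simp [hxy, hx]

theorem all_pauliX_mulVec_ketOne (n : ℕ) : (Layer.all n pauliX).op *ᵥ ketOne n = ketZero n := by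
  rw [Layer.op_all]
  funext x
  rw [ketOne, Matrix.mulVec_single_one, ketZero, Pi.single_apply, Matrix.col_apply, piTensor_apply]
  have : ∀ a : Fin 2, (pauliX : Matrix (Fin 2) (Fin 2) ℂ) a 1 = if a = 0 then 1 else 0 := by
    intro a
    fin_cases a <;> simp [pauliX]
  simp only [Pi.one_apply, this, Finset.prod_ite_zero, funext_iff]
  simp

theorem all_pauliX_conjTranspose (n : ℕ) :
    ((Layer.all n pauliX).op)ᴴ = (Layer.all n pauliX).op := by
  rw [Layer.op_all]
  ext x y
  have : ∀ a b : Fin 2, star ((pauliX : Matrix (Fin 2) (Fin 2) ℂ) a b) =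
      (pauliX : Matrix (Fin 2) (Fin 2) ℂ) b a := by
    intro a b
    fin_cases a <;> fin_cases b <;> simp [pauliX]
  rw [Matrix.conjTranspose_apply, piTensor_apply, piTensor_apply, star_prod]
  exact Finset.prod_congr rfl fun j _ => this _ _

theorem hadamard_conjTranspose :
    (hadamard : Matrix (Fin 2) (Fin 2) ℂ)ᴴ = (hadamard : Matrix (Fin 2) (Fin 2) ℂ) := by
  ext a b
  fin_cases a <;> fin_cases b <;> simp [hadamard, Matrix.conjTranspose_apply]

theorem single_hadamard_conjTranspose (q : ℕ) :
    ((Layer.single (0 : Fin (q + 1)) hadamard).op)ᴴ =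
      (Layer.single (0 : Fin (q + 1)) hadamard).op := by
  rw [Layer.op_single_zero, ancTensor_conjTranspose, hadamard_conjTranspose,
    Matrix.conjTranspose_one]

theorem ancTensor_one_mulVec_plusTensor {q : ℕ} (N : Op q) (φ : Basis q → ℂ) :
    ancTensor 1 N *ᵥ plusTensor φ = plusTensor (N *ᵥ φ) := by
  funext x
  simp only [Matrix.mulVec, dotProduct, plusTensor, ancTensor, Matrix.of_apply, sum_basis_succ,
    Fin.cons_zero, Fin.tail_cons, Matrix.one_apply, ite_mul, one_mul, zero_mul]
  rw [Finset.sum_eq_single (x 0) (fun b _ hb => by simp [hb.symm]) (by simp), Finset.mul_sum]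
  refine Finset.sum_congr rfl fun z _ => ?_
  simp only [if_true]
  ring

theorem single_hadamard_mulVec_ketZero (q : ℕ) :
    (Layer.single (0 : Fin (q + 1)) hadamard).op *ᵥ ketZero (q + 1) = plusTensor (ketZero q) := by
  rw [Layer.op_single_zero]
  funext x
  rw [ketZero, Matrix.mulVec_single_one, Matrix.col_apply]
  have h : ∀ a : Fin 2, (hadamard : Matrix (Fin 2) (Fin 2) ℂ) a 0 =
      ((1 / Real.sqrt 2 : ℝ) : ℂ) := by
    intro a
    fin_cases a <;> simp [hadamard]
  have h0 : Fin.tail (0 : Basis (q + 1)) = 0 := rfl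
  simp only [ancTensor, Matrix.of_apply, Pi.zero_apply, h, plusTensor, ketZero, Matrix.one_apply,
    Pi.single_apply, h0]

/-- The circuit preparing `|Ψ⟩` from `|1…1⟩`. -/
noncomputable def prepareCircuit {q : ℕ} (A : Circuit q) : Circuit (q + 1) :=
  [Layer.all (q + 1) pauliX] ++ [Layer.single 0 hadamard] ++ A.onSystem

theorem prepareCircuit_mulVec {q : ℕ} (A : Circuit q) :
    (prepareCircuit A).op *ᵥ ketOne (q + 1) = trialState A := by
  rw [prepareCircuit, Circuit.op_append, Circuit.op_append, Circuit.op_singleton,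
    Circuit.op_singleton, ← Matrix.mulVec_mulVec, ← Matrix.mulVec_mulVec, all_pauliX_mulVec_ketOne,
    single_hadamard_mulVec_ketZero, Circuit.op_onSystem, ancTensor_one_mulVec_plusTensor,
    trialState]

/-- The circuit is the inverse of `prepareCircuit`, then `Z`, then `prepareCircuit`, since the
Hadamard and `X` layers are self-adjoint. -/
theorem op_reflectionCircuit {q : ℕ} (A : Circuit q) {Z : Circuit (q + 1)}
    (hZ : Z.op = multiControlledZ (q + 1)) :
    (reflectionCircuit A Z).op = householder (trialState A) := by
  rw [← prepareCircuit_mulVec, ← householder_conj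
    (Matrix.mem_unitaryGroup_iff.1 (prepareCircuit A).op_mem_unitary),
    ← multiControlledZ_eq_householder, ← hZ]
  simp only [reflectionCircuit, prepareCircuit, Circuit.op_append, Circuit.op_singleton,
    Circuit.op_adjoint, Matrix.conjTranspose_mul, single_hadamard_conjTranspose,
    all_pauliX_conjTranspose, mul_assoc]

theorem depth_reflectionCircuit {q : ℕ} (A : Circuit q) (Z : Circuit (q + 1)) :
    (reflectionCircuit A Z).depth = 2 * A.depth + Z.depth + 4 := by
  simp [reflectionCircuit]
  ring

theorem depth_roundCircuit {q : ℕ} (A : Circuit q) (R U : Circuit (q + 1)) :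
    (roundCircuit A R U).depth = A.depth + 2 * (R.depth + U.depth) := by
  simp [roundCircuit]
  ring

theorem op_roundCircuit_mulVec {q : ℕ} (A : Circuit q) (R U : Circuit (q + 1)) :
    (roundCircuit A R U).op *ᵥ plusTensor (ketZero q) =
      (R.op * U.op * R.op * U.opᴴ) *ᵥ trialState A := by
  simp only [roundCircuit, Circuit.op_append, Circuit.op_adjoint, Circuit.op_onSystem]
  rw [trialState, ← ancTensor_one_mulVec_plusTensor]
  simp only [Matrix.mulVec_mulVec, mul_assoc]

/-! ### Product formulas in a Banach algebra -/

set_option linter.unusedSectionVars false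

section ProductFormula

open NormedSpace

variable {A : Type*} [NormedRing A] [NormedAlgebra ℂ A]

theorem norm_exp_le [NormOneClass A] (x : A) : ‖exp x‖ ≤ Real.exp ‖x‖ := by
  rw [exp_eq_tsum ℂ, Real.exp_eq_exp_ℝ, exp_eq_tsum ℝ]
  refine (norm_tsum_le_tsum_norm (norm_expSeries_summable' (𝕂 := ℂ) x)).trans ?_
  refine Summable.tsum_le_tsum (fun n => ?_) (norm_expSeries_summable' (𝕂 := ℂ) x)
    (expSeries_summable' (𝕂 := ℝ) ‖x‖)
  rw [norm_smul, norm_inv, Complex.norm_natCast, smul_eq_mul]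
  gcongr
  exact norm_pow_le x n

/-- The ordered product of the exponentials `e^{c z h_l}` over the pairs `(c, l)` in a list. -/
noncomputable def productFormula {ι : Type*} (h : ι → A) (s : List (ℝ × ι)) (z : ℂ) : A :=
  (s.map fun c => exp (((c.1 : ℂ) * z) • h c.2)).prod

/-- Multiply all coefficients of a list by `r`. -/
def scaleSchedule {ι : Type*} (r : ℝ) (s : List (ℝ × ι)) : List (ℝ × ι) :=
  s.map fun c => (r * c.1, c.2)

variable {ι : Type*} (h : ι → A)

@[simp] theorem productFormula_nil (z : ℂ) : productFormula h [] z = 1 := rfl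

theorem productFormula_cons (c : ℝ × ι) (s : List (ℝ × ι)) (z : ℂ) :
    productFormula h (c :: s) z = exp (((c.1 : ℂ) * z) • h c.2) * productFormula h s z := by
  simp [productFormula]

theorem productFormula_append (s t : List (ℝ × ι)) (z : ℂ) :
    productFormula h (s ++ t) z = productFormula h s z * productFormula h t z := by
  simp [productFormula]

theorem productFormula_scale (r : ℝ) (s : List (ℝ × ι)) (z : ℂ) :
    productFormula h (scaleSchedule r s) z = productFormula h s (r * z) := by
  simp only [productFormula, scaleSchedule, List.map_map]
  congr 2
  funext c
  simp only [Function.comp, Complex.ofReal_mul]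
  congr 2
  ring

theorem productFormula_zero (s : List (ℝ × ι)) : productFormula h s 0 = 1 := by
  induction s with
  | nil => rfl
  | cons c s ih => rw [productFormula_cons, ih]; simp

variable [CompleteSpace A]

/-- The factors cancel in pairs from the middle outwards. For a palindromic list this is time
symmetry. -/
theorem productFormula_reverse_neg_mul (s : List (ℝ × ι)) (z : ℂ) :
    productFormula h s.reverse (-z) * productFormula h s z = 1 := by
  let _ : NormedAlgebra ℚ A := NormedAlgebra.restrictScalars ℚ ℂ A
  induction s with
  | nil => simp
  | cons c s ih =>
    rw [List.reverse_cons, productFormula_append, productFormula_cons, productFormula_cons,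
      productFormula_nil, mul_one, mul_assoc, ← mul_assoc (exp _) (exp _), mul_neg, neg_smul,
      ← exp_add_of_commute (Commute.refl _).neg_left, neg_add_cancel, exp_zero, one_mul, ih]

theorem differentiable_exp_mul_smul (c : ℂ) (x : A) :
    Differentiable ℂ fun z : ℂ => exp ((c * z) • x) := by
  have h1 : Differentiable ℂ fun t : ℂ => exp (t • x) := fun t =>
    (hasDerivAt_exp_smul_const x t).differentiableAt
  exact h1.comp (differentiable_id.const_mul c)

theorem differentiable_productFormula (s : List (ℝ × ι)) :
    Differentiable ℂ (productFormula h s) := by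
  induction s with
  | nil => exact differentiable_const _
  | cons c s ih =>
    have : productFormula h (c :: s) =
        fun z => exp (((c.1 : ℂ) * z) • h c.2) * productFormula h s z :=
      funext fun z => productFormula_cons h c s z
    rw [this]
    exact (differentiable_exp_mul_smul _ _).mul ih

theorem hasDerivAt_exp_mul_smul_zero (c : ℂ) (x : A) :
    HasDerivAt (fun z : ℂ => exp ((c * z) • x)) (c • x) 0 := by
  have h1 := hasDerivAt_exp_smul_const (𝕂 := ℂ) x (c * 0)
  have h2 : HasDerivAt (fun z : ℂ => c * z) c 0 := by
    simpa using (hasDerivAt_id (0 : ℂ)).const_mul c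
  have h3 := h1.scomp (0 : ℂ) h2
  rw [mul_zero, zero_smul, exp_zero, one_mul] at h3
  exact h3

theorem hasDerivAt_productFormula_zero (s : List (ℝ × ι)) :
    HasDerivAt (productFormula h s) (s.map fun c => (c.1 : ℂ) • h c.2).sum 0 := by
  induction s with
  | nil => exact hasDerivAt_const _ _
  | cons c s ih =>
    have : productFormula h (c :: s) =
        fun z => exp (((c.1 : ℂ) * z) • h c.2) * productFormula h s z :=
      funext fun z => productFormula_cons h c s z
    rw [this]
    have := (hasDerivAt_exp_mul_smul_zero (c.1 : ℂ) (h c.2)).mul ih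
    rw [productFormula_zero, mul_zero, zero_smul, exp_zero, one_mul, mul_one] at this
    rw [List.map_cons, List.sum_cons]
    exact this

/-- A growth bound for all complex times, as needed on the circle in the maximum principle. -/
theorem norm_productFormula_le [NormOneClass A] (hh : ∀ l, ‖h l‖ ≤ 1) (s : List (ℝ × ι))
    (hs : ∀ c ∈ s, |c.1| ≤ 1) (z : ℂ) :
    ‖productFormula h s z‖ ≤ Real.exp (s.length * ‖z‖) := by
  induction s with
  | nil => simp
  | cons c s ih =>
    rw [productFormula_cons, List.length_cons, Nat.cast_add, Nat.cast_one, add_comm, add_mul,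
      Real.exp_add, one_mul]
    refine (norm_mul_le _ _).trans ?_
    refine mul_le_mul ((norm_exp_le _).trans (Real.exp_le_exp.2 ?_))
      (ih fun c hc => hs c (List.mem_cons_of_mem _ hc)) (norm_nonneg _) (Real.exp_nonneg _)
    rw [norm_smul, norm_mul, Complex.norm_real, Real.norm_eq_abs]
    have h1 := hs c List.mem_cons_self
    calc |c.1| * ‖z‖ * ‖h c.2‖ ≤ 1 * ‖z‖ * 1 := by gcongr; exact hh _
      _ = ‖z‖ := by ring

/-! ### Leading error coefficients -/

/-- `F(z) = e^{a z H} + zⁿ g(z)` with an entire function `g` such that `g(0) = e`. -/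
def ApproxExp (H : A) (n : ℕ) (a : ℂ) (e : A) (F : ℂ → A) : Prop :=
  ∃ g : ℂ → A, Differentiable ℂ g ∧ g 0 = e ∧ ∀ z, F z = exp ((a * z) • H) + z ^ n • g z

variable {H : A} {n : ℕ} {a b : ℂ} {e e' : A} {F G : ℂ → A}

theorem exp_mul_smul_add (H : A) (a b z : ℂ) :
    exp ((a * z) • H) * exp ((b * z) • H) = exp (((a + b) * z) • H) := by
  let _ : NormedAlgebra ℚ A := NormedAlgebra.restrictScalars ℚ ℂ A
  rw [← exp_add_of_commute (((Commute.refl H).smul_left _).smul_right _), ← add_smul, add_mul]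

/-- Expanding the product leaves two cross terms at order `zⁿ`, whose values at `0` are `e'` and
`e`; the product of the two errors is of order `z²ⁿ`, which is why `n ≠ 0` matters. -/
theorem ApproxExp.mul (hn : n ≠ 0) (hF : ApproxExp H n a e F) (hG : ApproxExp H n b e' G) :
    ApproxExp H n (a + b) (e + e') fun z => F z * G z := by
  obtain ⟨f, hf, hf0, hFf⟩ := hF
  obtain ⟨g, hg, hg0, hGg⟩ := hG
  refine ⟨fun z => exp ((a * z) • H) * g z + f z * exp ((b * z) • H) + z ^ n • (f z * g z),
    ?_, ?_, fun z => ?_⟩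
  · exact (((differentiable_exp_mul_smul a H).mul hg).add
      (hf.mul (differentiable_exp_mul_smul b H))).add ((differentiable_pow n).smul (hf.mul hg))
  · simp [hf0, hg0, hn, add_comm]
  · rw [← exp_mul_smul_add]
    simp only [hFf, hGg, mul_add, add_mul, smul_add, mul_smul_comm, smul_mul_assoc]
    abel

theorem ApproxExp.scale (hF : ApproxExp H n 1 e F) (c : ℂ) :
    ApproxExp H n c (c ^ n • e) fun z => F (c * z) := by
  obtain ⟨f, hf, hf0, hFf⟩ := hF
  refine ⟨fun z => c ^ n • f (c * z), ?_, by simp [hf0], fun z => ?_⟩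
  · exact (hf.comp (differentiable_id.const_mul c)).const_smul (c ^ n)
  · simp only [hFf, one_mul, mul_pow, mul_comm (c ^ n), mul_smul]

/-- An entire function vanishing at `0` is `z` times an entire function, its divided difference at
`0`. -/
theorem ApproxExp.succ (hF : ApproxExp H n a 0 F) : ∃ e, ApproxExp H (n + 1) a e F := by
  obtain ⟨f, hf, hf0, hFf⟩ := hF
  refine ⟨_, dslope f 0, ?_, rfl, fun z => ?_⟩
  · rw [← differentiableOn_univ, Complex.differentiableOn_dslope Filter.univ_mem]
    exact hf.differentiableOn
  · have := sub_smul_dslope f 0 z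
    rw [sub_zero, hf0, sub_zero] at this
    rw [hFf, pow_succ, mul_smul (z ^ n) z, this]

theorem approxExp_of_apply_zero (hF : Differentiable ℂ F) (hF0 : F 0 = 1) :
    ApproxExp H 1 1 (deriv F 0 - H) F := by
  have hd : Differentiable ℂ fun z => F z - exp ((1 * z) • H) :=
    hF.sub (differentiable_exp_mul_smul 1 H)
  refine ⟨dslope (fun z => F z - exp ((1 * z) • H)) 0, ?_, ?_, fun z => ?_⟩
  · rw [← differentiableOn_univ, Complex.differentiableOn_dslope Filter.univ_mem]
    exact hd.differentiableOn
  · rw [dslope_same]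
    have := ((hF 0).hasDerivAt.sub (hasDerivAt_exp_mul_smul_zero 1 H)).deriv
    rw [one_smul] at this
    exact this
  · have := sub_smul_dslope (fun z => F z - exp ((1 * z) • H)) 0 z
    rw [sub_zero] at this
    rw [pow_one, this]
    simp [hF0]

/-- The leading error term of a time-symmetric formula has odd degree. -/
theorem ApproxExp.eq_zero_of_symmetric (hn : Even n) (hn0 : n ≠ 0) (hF : ApproxExp H n 1 e F)
    (hs : ∀ z, F (-z) * F z = 1) : e = 0 := by
  -- `F(-z) F(z)` approximates `e^{0·zH} = 1` with leading coefficient `(-1)ⁿ e + e = 2e`; being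
  -- exactly `1`, it has zero error, so `2e = 0`.
  have h2 := (hF.scale (-1)).mul hn0 hF
  rw [hn.neg_one_pow, one_smul, neg_add_cancel] at h2
  obtain ⟨g, hg, hg0, hFg⟩ := h2
  have hz : ∀ z, z ≠ 0 → g z = 0 := fun z hz => by
    have := hFg z
    simp only [neg_one_mul] at this
    rw [ hs, zero_mul, zero_smul, exp_zero] at this
    have h3 : z ^ n • g z = 0 := by simpa using this.symm
    exact (smul_eq_zero.1 h3).resolve_left (pow_ne_zero _ hz)
  have hc : g = fun _ => 0 := by
    refine Continuous.ext_on (dense_compl_singleton (0 : ℂ)) hg.continuous continuous_const ?_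
    intro z hz'
    exact hz z hz'
  rw [hc] at hg0
  have h4 : (2 : ℂ) • e = 0 := by rw [two_smul]; exact hg0.symm
  exact (smul_eq_zero.1 h4).resolve_left two_ne_zero

/-- The quotient of the error by `zⁿ` is entire, so the maximum principle on the disc of radius
`1/B` bounds it by its values on the circle. There `F` and the exponential each have norm at most
`exp 1`, and `2 exp 1 ≤ 6`. -/
theorem ApproxExp.norm_sub_le [NormOneClass A] (hF : ApproxExp H n 1 e F) {B : ℝ} (hB : 0 < B)
    (hH : ‖H‖ ≤ B) (hb : ∀ z, ‖F z‖ ≤ Real.exp (B * ‖z‖)) {z : ℂ} (hz : B * ‖z‖ ≤ 1) :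
    ‖F z - exp (z • H)‖ ≤ 6 * (B * ‖z‖) ^ n := by
  obtain ⟨g, hg, -, hFg⟩ := hF
  simp only [one_mul] at hFg
  have hfr : ∀ w ∈ frontier (Metric.ball (0 : ℂ) B⁻¹), ‖g w‖ ≤ 6 * B ^ n := by
    intro w hw
    rw [frontier_ball _ (by positivity), mem_sphere_zero_iff_norm] at hw
    have h1 : w ^ n • g w = F w - exp (w • H) := by rw [hFg, add_sub_cancel_left]
    have h2 : ‖F w‖ ≤ Real.exp 1 := (hb w).trans (by rw [hw, mul_inv_cancel₀ hB.ne'])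
    have h3 : ‖exp (w • H)‖ ≤ Real.exp 1 := by
      refine (norm_exp_le _).trans (Real.exp_le_exp.2 ?_)
      rw [norm_smul, hw]
      calc B⁻¹ * ‖H‖ ≤ B⁻¹ * B := by gcongr
        _ = 1 := inv_mul_cancel₀ hB.ne'
    have h4 : (B⁻¹) ^ n * ‖g w‖ ≤ 6 := by
      rw [← hw, ← norm_pow, ← norm_smul, h1]
      have := Real.exp_one_lt_d9
      exact (_root_.norm_sub_le _ _).trans (by linarith)
    rw [inv_pow, inv_mul_le_iff₀ (by positivity)] at h4
    linarith
  have hzc : z ∈ closure (Metric.ball (0 : ℂ) B⁻¹) := by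
    rw [closure_ball _ (by positivity), mem_closedBall_zero_iff]
    rwa [← one_div, le_div_iff₀' hB]
  have := Complex.norm_le_of_forall_mem_frontier_norm_le Metric.isBounded_ball
    hg.diffContOnCl hfr hzc
  rw [hFg, add_sub_cancel_left, norm_smul, norm_pow, mul_pow]
  calc ‖z‖ ^ n * ‖g z‖ ≤ ‖z‖ ^ n * (6 * B ^ n) := by gcongr
    _ = _ := by ring

end ProductFormula

/-! ### The Suzuki recursion -/

/-- The coefficient `1 / (4 - 4^{1/(2j-1)})` with `j = k + 2`. -/
noncomputable def suzukiCoeff (k : ℕ) : ℝ := 1 / (4 - (4 : ℝ) ^ (1 / (2 * (k + 2 : ℝ) - 1)))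

/-- With `x = 4^{1/(2k+3)}` and `p = 1/(4 - x)` one has `1 - 4p = -xp`, and the odd power of `x` is
`4`, so the two contributions cancel. The bounds on `p` follow from `1 ≤ x ≤ 2` and keep both `p`
and `1 - 4p` in `[-1, 1]`. -/
theorem suzukiCoeff_spec (k : ℕ) : 1 / 3 ≤ suzukiCoeff k ∧ suzukiCoeff k ≤ 1 / 2 ∧
    4 * suzukiCoeff k ^ (2 * k + 3) + (1 - 4 * suzukiCoeff k) ^ (2 * k + 3) = 0 := by
  set x : ℝ := (4 : ℝ) ^ (1 / (2 * (k + 2 : ℝ) - 1)) with hx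
  have hk : (0 : ℝ) ≤ k := k.cast_nonneg
  have hpos : 0 < 2 * (k + 2 : ℝ) - 1 := by linarith
  have h1 : 1 ≤ x := Real.one_le_rpow (by norm_num) (by positivity)
  have h2 : x ≤ 2 := by
    calc x ≤ (4 : ℝ) ^ (1 / 2 : ℝ) := by
          refine Real.rpow_le_rpow_of_exponent_le (by norm_num) ?_
          exact one_div_le_one_div_of_le (by norm_num) (by linarith)
      _ = 2 := by
          rw [show (4 : ℝ) = 2 ^ (2 : ℝ) by norm_num, ← Real.rpow_mul (by norm_num)]
          norm_num
  have h3 : x ^ (2 * k + 3) = 4 := by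
    rw [hx, ← Real.rpow_natCast, ← Real.rpow_mul (by norm_num)]
    push_cast
    rw [show 1 / (2 * (k + 2 : ℝ) - 1) * (2 * k + 3) = 1 by
      rw [show (2 * (k : ℝ) + 3) = 2 * (k + 2 : ℝ) - 1 by ring]; field_simp, Real.rpow_one]
  have hp : suzukiCoeff k = 1 / (4 - x) := rfl
  have h4 : 0 < 4 - x := by linarith
  refine ⟨?_, ?_, ?_⟩
  · rw [hp]; exact one_div_le_one_div_of_le h4 (by linarith)
  · rw [hp]; exact one_div_le_one_div_of_le (by norm_num) (by linarith)
  · have h5 : 1 - 4 * suzukiCoeff k = -(x * suzukiCoeff k) := by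
      rw [hp]; field_simp; ring
    rw [h5, Odd.neg_pow ⟨k + 1, by ring⟩, mul_pow, h3]
    ring

/-- The exponentials of the product formula of order `2κ`, as pairs of a coefficient and the index
of a term. -/
noncomputable def suzukiSchedule (L : ℕ) : ℕ → List (ℝ × Fin L)
  | 0 => []
  | 1 => List.ofFn (fun l => (1 / 2, l)) ++ (List.ofFn fun l => (1 / 2, l)).reverse
  | k + 2 =>
      let s := scaleSchedule (suzukiCoeff k) (suzukiSchedule L (k + 1))
      s ++ s ++ scaleSchedule (1 - 4 * suzukiCoeff k) (suzukiSchedule L (k + 1)) ++ s ++ s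

theorem length_suzukiSchedule_le (L κ : ℕ) : (suzukiSchedule L κ).length ≤ 2 * L * 5 ^ κ := by
  induction κ using Nat.twoStepInduction with
  | zero => simp [suzukiSchedule]
  | one => simp [suzukiSchedule]; omega
  | more k _ ih =>
    simp only [suzukiSchedule, scaleSchedule, List.length_append, List.length_map]
    rw [pow_succ, ← mul_assoc]
    omega

theorem abs_le_one_of_mem_suzukiSchedule (L κ : ℕ) : ∀ c ∈ suzukiSchedule L κ, |c.1| ≤ 1 := by
  induction κ using Nat.twoStepInduction with
  | zero => simp [suzukiSchedule]
  | one =>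
    intro c hc
    simp only [suzukiSchedule, List.mem_append, List.mem_reverse, or_self, List.mem_ofFn] at hc
    obtain ⟨l, rfl⟩ := hc
    norm_num [abs_le]
  | more k _ ih =>
    obtain ⟨h1, h2, -⟩ := suzukiCoeff_spec k
    have key : ∀ r : ℝ, |r| ≤ 1 → ∀ c ∈ scaleSchedule r (suzukiSchedule L (k + 1)), |c.1| ≤ 1 := by
      intro r hr c hc
      obtain ⟨d, hd, rfl⟩ := List.mem_map.1 hc
      rw [abs_mul]
      exact mul_le_one₀ hr (abs_nonneg _) (ih d hd)
    have hp := key (suzukiCoeff k) (abs_le.2 ⟨by linarith, by linarith⟩)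
    have hr := key (1 - 4 * suzukiCoeff k) (abs_le.2 ⟨by linarith, by linarith⟩)
    intro c hc
    simp only [suzukiSchedule, List.mem_append] at hc
    rcases hc with (((hc | hc) | hc) | hc) | hc
    exacts [hp c hc, hp c hc, hr c hc, hp c hc, hp c hc]

theorem reverse_suzukiSchedule (L κ : ℕ) :
    (suzukiSchedule L κ).reverse = suzukiSchedule L κ := by
  induction κ using Nat.twoStepInduction with
  | zero => rfl
  | one => simp [suzukiSchedule]
  | more k _ ih =>
    simp only [suzukiSchedule, scaleSchedule, List.reverse_append, ← List.map_reverse, ih,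
      List.append_assoc]

section Order

variable {A : Type*} [NormedRing A] [NormedAlgebra ℂ A] [CompleteSpace A] {L : ℕ} (h : Fin L → A)

theorem productFormula_suzuki_symmetric (κ : ℕ) (z : ℂ) :
    productFormula h (suzukiSchedule L κ) (-z) * productFormula h (suzukiSchedule L κ) z = 1 := by
  have := productFormula_reverse_neg_mul h (suzukiSchedule L κ) z
  rwa [reverse_suzukiSchedule] at this

theorem productFormula_suzuki_succ (k : ℕ) (z : ℂ) :
    productFormula h (suzukiSchedule L (k + 2)) z =
      productFormula h (suzukiSchedule L (k + 1)) (suzukiCoeff k * z) ^ 2 *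
        productFormula h (suzukiSchedule L (k + 1)) ((1 - 4 * suzukiCoeff k : ℝ) * z) *
        productFormula h (suzukiSchedule L (k + 1)) (suzukiCoeff k * z) ^ 2 := by
  simp only [suzukiSchedule, productFormula_append, productFormula_scale, sq, mul_assoc]

/-- Symmetry kills the next, even, leading coefficient, so one cancelled odd order gains two. -/
theorem approxExp_succ_of_symmetric {H : A} {n : ℕ} {F : ℂ → A} (hn : Odd n)
    (hF : ApproxExp H n 1 0 F) (hs : ∀ z, F (-z) * F z = 1) :
    ∃ e, ApproxExp H (n + 2) 1 e F := by
  obtain ⟨e, he⟩ := hF.succ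
  have := he.eq_zero_of_symmetric hn.add_one (by omega) hs
  subst this
  exact he.succ

/-- The base case needs only that the coefficients of each term add up to `1`. In the recursion the
five time fractions add up to `1`, and `suzukiCoeff_spec` cancels the leading error; symmetry
supplies the second order. -/
theorem approxExp_suzuki (k : ℕ) : ∃ e, ApproxExp (∑ l, h l) (2 * k + 3) 1 e
    (productFormula h (suzukiSchedule L (k + 1))) := by
  induction k with
  | zero =>
    have h1 := approxExp_of_apply_zero (H := ∑ l, h l)
      (differentiable_productFormula h (suzukiSchedule L 1)) (productFormula_zero h _)
    rw [(hasDerivAt_productFormula_zero h _).deriv] at h1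
    have h2 : ((suzukiSchedule L 1).map fun c => (c.1 : ℂ) • h c.2).sum = ∑ l, h l := by
      simp only [suzukiSchedule, List.map_append, List.map_reverse, List.sum_append,
        List.sum_reverse, List.map_ofFn, List.sum_ofFn, Function.comp, ← Finset.sum_add_distrib]
      refine Finset.sum_congr rfl fun l _ => ?_
      rw [← add_smul]
      norm_num
    rw [h2, sub_self] at h1
    exact approxExp_succ_of_symmetric odd_one h1 (productFormula_suzuki_symmetric h 1)
  | succ k ih =>
    obtain ⟨e, he⟩ := ih
    have hn : 2 * k + 3 ≠ 0 := by omega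
    have hp := he.scale (suzukiCoeff k : ℂ)
    have hr := he.scale ((1 - 4 * suzukiCoeff k : ℝ) : ℂ)
    have h5 := (((hp.mul hn hp).mul hn hr).mul hn (hp.mul hn hp))
    have hsum : (suzukiCoeff k : ℂ) + suzukiCoeff k + ((1 - 4 * suzukiCoeff k : ℝ) : ℂ) +
        (suzukiCoeff k + suzukiCoeff k) = 1 := by
      push_cast; ring
    have hc : (4 * (suzukiCoeff k : ℂ) ^ (2 * k + 3) +
        ((1 - 4 * suzukiCoeff k : ℝ) : ℂ) ^ (2 * k + 3)) = 0 := by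
      exact_mod_cast (suzukiCoeff_spec k).2.2
    simp only [← add_smul] at h5
    rw [hsum, show (suzukiCoeff k : ℂ) ^ (2 * k + 3) + (suzukiCoeff k : ℂ) ^ (2 * k + 3) +
      ((1 - 4 * suzukiCoeff k : ℝ) : ℂ) ^ (2 * k + 3) +
      ((suzukiCoeff k : ℂ) ^ (2 * k + 3) + (suzukiCoeff k : ℂ) ^ (2 * k + 3)) = 0 by
        rw [← hc]; ring, zero_smul] at h5
    refine approxExp_succ_of_symmetric (n := 2 * k + 3) ⟨k + 1, by ring⟩ ?_
      (productFormula_suzuki_symmetric h (k + 2))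
    convert h5 using 2 with z
    rw [productFormula_suzuki_succ, sq]

/-- The error of one step of the product formula of order `2κ`. -/
theorem norm_productFormula_suzuki_sub_le [NormOneClass A] (hh : ∀ l, ‖h l‖ ≤ 1) {κ : ℕ}
    (hκ : 1 ≤ κ) {B : ℝ} (hB : 0 < B) (hL : 2 * (L : ℝ) * 5 ^ κ ≤ B) {z : ℂ} (hz : B * ‖z‖ ≤ 1) :
    ‖productFormula h (suzukiSchedule L κ) z - NormedSpace.exp (z • ∑ l, h l)‖ ≤
      6 * (B * ‖z‖) ^ (2 * κ + 1) := by
  obtain ⟨k, rfl⟩ := Nat.exists_eq_add_of_le' hκ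
  obtain ⟨e, he⟩ := approxExp_suzuki h k
  -- The same `B` dominates the sum of the terms and the growth rate of the product formula, which
  -- is the number of its exponentials.
  refine he.norm_sub_le hB ?_ (fun z => ?_) hz
  · refine (norm_sum_le_of_le _ fun l _ => hh l).trans (le_trans ?_ hL)
    have : (1 : ℝ) ≤ 5 ^ (k + 1) := one_le_pow₀ (by norm_num)
    simp only [Finset.sum_const, Finset.card_univ, Fintype.card_fin, nsmul_eq_mul, mul_one]
    nlinarith [(L.cast_nonneg : (0 : ℝ) ≤ L)]
  · refine (norm_productFormula_le h hh _ (abs_le_one_of_mem_suzukiSchedule L _) z).trans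
      (Real.exp_le_exp.2 ?_)
    gcongr
    refine le_trans ?_ hL
    exact_mod_cast length_suzukiSchedule_le L (k + 1)

end Order

/-! ### Circuits for controlled Pauli exponentials -/

section Flip

variable {R : Type*} [Ring R] [Algebra ℂ R]

/-- For commuting involutions `Y`, `K`: apply `Y` on the `-1` eigenspace of `K`. -/
noncomputable def conditionalFlip (Y K : R) : R := (1 / 2 : ℂ) • ((1 + K) + Y * (1 - K))

theorem conditionalFlip_mul_self {Y K : R} (hY : Y * Y = 1) (hK : K * K = 1) (hYK : Commute Y K) :
    conditionalFlip Y K * conditionalFlip Y K = 1 := by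
  have hc : (1 + K) * Y = Y * (1 + K) := by rw [add_mul, mul_add, hYK.eq, one_mul, mul_one]
  have hc' : (1 - K) * Y = Y * (1 - K) := by rw [sub_mul, mul_sub, hYK.eq, one_mul, mul_one]
  have h1 : (1 + K) * (1 + K) = (2 : ℂ) • (1 + K) := by
    simp only [add_mul, mul_add, hK, two_smul, one_mul, mul_one]; abel
  have h2 : (1 - K) * (1 - K) = (2 : ℂ) • (1 - K) := by
    simp only [sub_mul, mul_sub, hK, two_smul, one_mul, mul_one]; abel
  have h3 : (1 + K) * (1 - K) = 0 := by
    simp only [add_mul, mul_sub, hK, one_mul, mul_one]; abel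
  have h4 : (1 - K) * (1 + K) = 0 := by
    simp only [sub_mul, mul_add, hK, one_mul, mul_one]; abel
  have h5 : (1 + K) * (Y * (1 - K)) = 0 := by rw [← mul_assoc, hc, mul_assoc, h3, mul_zero]
  have h6 : Y * (1 - K) * (1 + K) = 0 := by rw [mul_assoc, h4, mul_zero]
  have h7 : Y * (1 - K) * (Y * (1 - K)) = (2 : ℂ) • (1 - K) := by
    rw [mul_assoc, ← mul_assoc (1 - K), hc', mul_assoc Y, h2, ← mul_assoc, hY, one_mul]
  rw [conditionalFlip, smul_mul_smul_comm, add_mul (1 + K), mul_add (1 + K) (1 + K),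
    mul_add (Y * (1 - K)) (1 + K), h1, h5, h6, h7, add_zero,
    zero_add, ← smul_add, smul_smul, add_add_sub_cancel, ← two_smul ℂ (1 : R), smul_smul]
  norm_num

/-- Where `K = 1` nothing happens, and where `K = -1` conjugation by `Y` changes the sign of `Z`; in
both cases `Z` is multiplied by `K`. -/
theorem conditionalFlip_conj {Y K Z : R} (hY : Y * Y = 1) (hK : K * K = 1) (hYK : Commute Y K)
    (hKZ : Commute K Z) (hYZ : Y * Z = -(Z * Y)) :
    conditionalFlip Y K * Z * conditionalFlip Y K = K * Z := by
  have h1 : conditionalFlip Y K * Z = (Z * K) * conditionalFlip Y K := by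
    have e1 : Y * (1 - K) * Z = -(Z * (Y * (1 - K))) := by
      rw [mul_assoc, sub_mul, one_mul, hKZ.eq, mul_sub, hYZ, ← mul_assoc Y Z K, hYZ]
      simp only [mul_sub, mul_one, neg_mul, mul_assoc]
      abel
    have e2 : K * (Y * (1 - K)) = -(Y * (1 - K)) := by
      rw [← mul_assoc, ← hYK.eq, mul_assoc, mul_sub, hK, mul_one, ← mul_neg, neg_sub]
    have e3 : K * (1 + K) = 1 + K := by rw [mul_add, hK, mul_one, add_comm]
    rw [conditionalFlip, smul_mul_assoc, mul_smul_comm, add_mul, e1, mul_assoc Z K, mul_add K, e2,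
      e3, mul_add, mul_neg]
    congr 2
    rw [add_mul, mul_add, hKZ.eq, one_mul, mul_one]
  rw [h1, mul_assoc, conditionalFlip_mul_self hY hK hYK, mul_one, hKZ.eq]

end Flip

/-! ### Pauli rotations controlled through the ancilla -/

theorem pauli_mul_self (a : Fin 4) : pauli a * pauli a = 1 := by
  fin_cases a <;> ext i j <;> fin_cases i <;> fin_cases j <;>
    simp [pauli, Matrix.mul_apply, Fin.sum_univ_two]

theorem pauli_conjTranspose (a : Fin 4) : (pauli a)ᴴ = pauli a := by
  fin_cases a <;> ext i j <;> fin_cases i <;> fin_cases j <;>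
    simp [pauli, Matrix.conjTranspose_apply]

theorem pauli_one_mul_three : pauli 1 * pauli 3 = -(pauli 3 * pauli 1) := by
  ext i j
  fin_cases i <;> fin_cases j <;> simp [pauli, Matrix.mul_apply, Fin.sum_univ_two]

open scoped Kronecker

/-- The two-qubit unitary applying `X` to the first qubit where the second one is in the `-1`
eigenspace of `σ_a`. -/
noncomputable def flipGate (a : Fin 4) : Matrix.unitaryGroup (Fin 2 × Fin 2) ℂ :=
  ⟨conditionalFlip (pauli 1 ⊗ₖ (1 : Matrix (Fin 2) (Fin 2) ℂ)) (1 ⊗ₖ pauli a), by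
    rw [Matrix.mem_unitaryGroup_iff, Matrix.star_eq_conjTranspose]
    have hc : Commute (pauli 1 ⊗ₖ (1 : Matrix (Fin 2) (Fin 2) ℂ)) (1 ⊗ₖ pauli a) := by
      simp [Commute, SemiconjBy, ← Matrix.mul_kronecker_mul]
    have hs : (conditionalFlip (pauli 1 ⊗ₖ (1 : Matrix (Fin 2) (Fin 2) ℂ)) (1 ⊗ₖ pauli a))ᴴ =
        conditionalFlip (pauli 1 ⊗ₖ (1 : Matrix (Fin 2) (Fin 2) ℂ)) (1 ⊗ₖ pauli a) := by
      simp only [conditionalFlip, Matrix.conjTranspose_smul, Matrix.conjTranspose_add, mul_sub,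
        Matrix.conjTranspose_sub, Matrix.conjTranspose_mul, Matrix.conjTranspose_kronecker,
        Matrix.conjTranspose_one, pauli_conjTranspose, hc.eq, mul_one]
      simp
    rw [hs]
    refine conditionalFlip_mul_self ?_ ?_ hc <;>
      rw [← Matrix.mul_kronecker_mul, pauli_mul_self, one_mul, Matrix.one_kronecker_one]⟩

theorem piTensor_mulSingle_mul_mulSingle_apply {n : ℕ} {i j : Fin n} (hij : i ≠ j)
    (M N : Matrix (Fin 2) (Fin 2) ℂ) (x y : Basis n) :
    (piTensor (Pi.mulSingle i M) * piTensor (Pi.mulSingle j N) : Op n) x y =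
      if ∀ k, k ≠ i → k ≠ j → x k = y k then (M ⊗ₖ N) (x i, x j) (y i, y j) else 0 := by
  rw [← map_mul, piTensor_apply, ← Finset.mul_prod_erase _ _ (Finset.mem_univ i),
    ← Finset.mul_prod_erase _ _ (Finset.mem_erase.2 ⟨hij.symm, Finset.mem_univ j⟩)]
  have : ∏ k ∈ (Finset.univ.erase i).erase j,
      (Pi.mulSingle i M * Pi.mulSingle j N : Fin n → Matrix (Fin 2) (Fin 2) ℂ) k (x k) (y k) =
      ∏ k ∈ (Finset.univ.erase i).erase j, if x k = y k then 1 else 0 := by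
    refine Finset.prod_congr rfl fun k hk => ?_
    simp only [Finset.mem_erase] at hk
    rw [Pi.mul_apply, Pi.mulSingle_eq_of_ne hk.1, Pi.mulSingle_eq_of_ne hk.2.1, one_mul,
      Matrix.one_apply]
  rw [this, Finset.prod_ite_zero, Pi.mul_apply, Pi.mul_apply, Pi.mulSingle_eq_same,
    Pi.mulSingle_eq_of_ne hij, Pi.mulSingle_eq_same, Pi.mulSingle_eq_of_ne hij.symm, one_mul,
    mul_one, Matrix.kronecker_apply]
  have hiff : (∀ k ∈ (Finset.univ.erase i).erase j, x k = y k) ↔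
      ∀ k, k ≠ i → k ≠ j → x k = y k := by
    simp only [Finset.mem_erase, Finset.mem_univ, and_true, and_imp]
    exact forall_congr' fun k => ⟨fun h a b => h b a, fun h a b => h b a⟩
  simp only [hiff]
  split_ifs <;> simp

theorem op_flipGate {n : ℕ} {i j : Fin n} (hij : i ≠ j) (a : Fin 4) :
    (Gate.two i j hij (flipGate a)).op = conditionalFlip
      (piTensor (Pi.mulSingle i (pauli 1))) (piTensor (Pi.mulSingle j (pauli a))) := by
  ext x y
  have h1 := piTensor_mulSingle_mul_mulSingle_apply hij 1 1 x y
  have h2 := piTensor_mulSingle_mul_mulSingle_apply hij 1 (pauli a) x y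
  have h3 := piTensor_mulSingle_mul_mulSingle_apply hij (pauli 1) 1 x y
  have h4 := piTensor_mulSingle_mul_mulSingle_apply hij (pauli 1) (pauli a) x y
  simp only [Pi.mulSingle_one, map_one, one_mul, mul_one] at h1 h2 h3
  simp only [Gate.op, flipGate, Matrix.of_apply, conditionalFlip, Matrix.smul_apply,
    Matrix.add_apply, mul_sub, mul_one, Matrix.sub_apply, h1, h2, h3, h4]
  rw [← Matrix.mul_kronecker_mul, one_mul, mul_one, Matrix.one_kronecker_one]
  split_ifs <;> simp

theorem piTensor_mulSingle_succ {q : ℕ} (j : Fin q) (M : Matrix (Fin 2) (Fin 2) ℂ) :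
    piTensor (Pi.mulSingle j.succ M) = ancTensor 1 (piTensor (Pi.mulSingle j M)) := by
  ext x y
  simp only [ancTensor, Matrix.of_apply, piTensor_apply, Fin.prod_univ_succ, Fin.tail]
  congr 1
  refine Finset.prod_congr rfl fun k _ => ?_
  by_cases hk : k = j
  · subst hk; simp
  · rw [Pi.mulSingle_eq_of_ne hk, Pi.mulSingle_eq_of_ne (by simpa using hk)]

theorem piTensor_mulSingle_zero {q : ℕ} (M : Matrix (Fin 2) (Fin 2) ℂ) :
    piTensor (Pi.mulSingle (0 : Fin (q + 1)) M) = ancTensor M 1 := by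
  ext x y
  have h1 : (1 : Op q) = piTensor 1 := (map_one _).symm
  simp only [h1, ancTensor, Matrix.of_apply, piTensor_apply, Fin.prod_univ_succ]
  simp only [Pi.mulSingle_eq_same, ne_eq, Fin.succ_ne_zero, not_false_eq_true,
    Pi.mulSingle_eq_of_ne]
  rfl

/-- Flip the ancilla conditionally on the Pauli matrices `σ_{v j}` of the listed qubits. -/
noncomputable def flipCircuit {q : ℕ} (v : Fin q → Fin 4) (l : List (Fin q)) : Circuit (q + 1) :=
  l.map fun j => ⟨[Gate.two 0 j.succ (Fin.succ_ne_zero j).symm (flipGate (v j))],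
    List.pairwise_singleton _ _⟩

/-- Each gate multiplies the system factor beside the ancilla `Z` by one Pauli matrix. The general
`N` is the product accumulated so far, which must commute with the Pauli matrices still to come. -/
theorem flipCircuit_conj {q : ℕ} (v : Fin q → Fin 4) (l : List (Fin q)) (N : Op q)
    (hN : ∀ j, Commute (piTensor (Pi.mulSingle j (pauli (v j)))) N) :
    (flipCircuit v l).op * ancTensor (pauli 3) N * (flipCircuit v l).opᴴ =
      ancTensor (pauli 3) ((l.map fun j => piTensor (Pi.mulSingle j (pauli (v j)))).prod * N) := by
  have hcomm : ∀ i j, Commute (piTensor (Pi.mulSingle i (pauli (v i))))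
      (piTensor (Pi.mulSingle j (pauli (v j))) : Op q) := fun i j => by
    by_cases hij : i = j
    · subst hij; exact Commute.refl _
    · have h : Commute (Pi.mulSingle i (pauli (v i)) : Fin q → Matrix (Fin 2) (Fin 2) ℂ)
          (Pi.mulSingle j (pauli (v j))) := Pi.mulSingle_commute hij _ _
      exact h.map piTensor
  induction l generalizing N with
  | nil => simp [flipCircuit]
  | cons a l ih =>
    set S : Op q := piTensor (Pi.mulSingle a (pauli (v a))) with hS
    set G : Op (q + 1) := conditionalFlip (ancTensor (pauli 1) 1) (ancTensor 1 S) with hG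
    have hop : (flipCircuit v (a :: l)).op = (flipCircuit v l).op * G := by
      simp only [flipCircuit, List.map_cons, Circuit.op_cons, Layer.op, List.map_nil,
        List.prod_singleton, op_flipGate, piTensor_mulSingle_succ, piTensor_mulSingle_zero]
      rfl
    have hSS : S * S = 1 := by
      rw [hS, ← map_mul, ← Pi.mulSingle_mul, pauli_mul_self, Pi.mulSingle_one, map_one]
    have hY : ancTensor (pauli 1) (1 : Op q) * ancTensor (pauli 1) 1 = 1 := by
      rw [ancTensor_mul, pauli_mul_self, one_mul, ancTensor_one_one]
    have hK : ancTensor 1 S * ancTensor 1 S = 1 := by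
      rw [ancTensor_mul, hSS, one_mul, ancTensor_one_one]
    have hYK : Commute (ancTensor (pauli 1) 1) (ancTensor 1 S) := by
      simp [Commute, SemiconjBy, ancTensor_mul]
    have hKZ : Commute (ancTensor 1 S) (ancTensor (pauli 3) N) := by
      simp [Commute, SemiconjBy, ancTensor_mul, (hN a).eq, hS]
    have hYZ : ancTensor (pauli 1) 1 * ancTensor (pauli 3) N =
        -(ancTensor (pauli 3) N * ancTensor (pauli 1) 1) := by
      rw [ancTensor_mul, ancTensor_mul, pauli_one_mul_three, one_mul, mul_one]
      ext x y
      simp [ancTensor]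
    have hGG : G * G = 1 := conditionalFlip_mul_self hY hK hYK
    have hGu : G * Gᴴ = 1 := by
      have := (flipCircuit v [a]).op_mem_unitary
      have h1 : (flipCircuit v [a]).op = G := by
        simp only [flipCircuit, List.map_cons, List.map_nil, Circuit.op_singleton, Layer.op,
          List.prod_singleton, op_flipGate, piTensor_mulSingle_succ, piTensor_mulSingle_zero]
        rfl
      rw [h1] at this
      exact Matrix.mem_unitaryGroup_iff.1 this
    -- A unitary involution is self-adjoint.
    have hGs : Gᴴ = G := by
      calc Gᴴ = G * G * Gᴴ := by rw [hGG, one_mul]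
        _ = G := by rw [mul_assoc, hGu, mul_one]
    have hconj : G * ancTensor (pauli 3) N * G = ancTensor (pauli 3) (S * N) := by
      rw [conditionalFlip_conj hY hK hYK hKZ hYZ, ancTensor_mul, one_mul]
    rw [hop, Matrix.conjTranspose_mul, hGs,
      show ∀ V W : Op (q + 1), V * G * ancTensor (pauli 3) N * (G * W) =
        V * (G * ancTensor (pauli 3) N * G) * W from fun V W => by simp only [mul_assoc], hconj,
      ih (S * N) fun j => (hcomm j a).mul_right (hN j), List.map_cons, List.prod_cons, ← mul_assoc]
    congr 2
    refine (Commute.list_prod_left _ _ ?_)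
    simp only [List.mem_map]
    rintro _ ⟨j, _, rfl⟩
    exact hcomm j a

theorem pauliString_eq_piTensor {q : ℕ} (v : Fin q → Fin 4) :
    pauliString v = piTensor fun j => pauli (v j) := rfl

theorem flipCircuit_conj_pauli {q : ℕ} (v : Fin q → Fin 4) :
    (flipCircuit v (List.finRange q)).op * ancTensor (pauli 3) 1 *
      (flipCircuit v (List.finRange q)).opᴴ = ancTensor (pauli 3) (pauliString v) := by
  rw [flipCircuit_conj v _ 1 fun j => Commute.one_right _, mul_one, pauliString_eq_piTensor,
    ← list_prod_mulSingle fun j => pauli (v j), map_list_prod, List.map_map]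
  rfl

/-- The one-qubit gate `e^{iθZ}`. -/
noncomputable def zRotation (θ : ℝ) : Matrix.unitaryGroup (Fin 2) ℂ :=
  ⟨(Real.cos θ : ℂ) • 1 + (Complex.I * Real.sin θ) • pauli 3, by
    have h := Complex.sin_sq_add_cos_sq θ
    have hI := Complex.I_sq
    rw [Matrix.mem_unitaryGroup_iff, Matrix.star_eq_conjTranspose, Matrix.conjTranspose_add,
      Matrix.conjTranspose_smul, Matrix.conjTranspose_smul, pauli_conjTranspose,
      Matrix.conjTranspose_one]
    simp only [star_mul', RCLike.star_def, Complex.conj_I, Complex.conj_ofReal, add_mul, mul_add,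
      smul_mul_smul_comm, one_mul, mul_one, pauli_mul_self]
    push_cast
    rw [show Complex.cos θ * (-Complex.I * Complex.sin θ) =
      -(Complex.I * Complex.sin θ * Complex.cos θ) by ring, neg_smul,
      show ∀ a b c d : Matrix (Fin 2) (Fin 2) ℂ, a + b + (-b + c) = a + c from fun _ _ _ _ => by
        abel, ← add_smul]
    · rw [show Complex.cos θ * Complex.cos θ +
        Complex.I * Complex.sin θ * (-Complex.I * Complex.sin θ) = 1 by
          linear_combination h - Complex.sin θ ^ 2 * hI, one_smul]
    -- The additive identity above quantifies over a fourth matrix that does not occur in it; any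
    -- value serves.
    · exact 0⟩

/-- A circuit for `e^{iθ Z ⊗ P}` with a Pauli string `P`. -/
noncomputable def rotationCircuit {q : ℕ} (v : Fin q → Fin 4) (θ : ℝ) : Circuit (q + 1) :=
  (flipCircuit v (List.finRange q)).adjoint ++ [Layer.single 0 (zRotation θ)] ++
    flipCircuit v (List.finRange q)

theorem depth_rotationCircuit {q : ℕ} (v : Fin q → Fin 4) (θ : ℝ) :
    (rotationCircuit v θ).depth = 2 * q + 1 := by
  have : (flipCircuit v (List.finRange q)).depth = q := by simp [flipCircuit, Circuit.depth]
  simp [rotationCircuit, this]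
  ring

theorem ancTensor_add_left {q : ℕ} (M M' : Matrix (Fin 2) (Fin 2) ℂ) (N : Op q) :
    ancTensor (M + M') N = ancTensor M N + ancTensor M' N := by
  ext x y
  simp [ancTensor, add_mul]

theorem ancTensor_smul_left {q : ℕ} (c : ℂ) (M : Matrix (Fin 2) (Fin 2) ℂ) (N : Op q) :
    ancTensor (c • M) N = c • ancTensor M N := by
  ext x y
  simp [ancTensor, mul_assoc]

theorem op_rotationCircuit {q : ℕ} (v : Fin q → Fin 4) (θ : ℝ) :
    (rotationCircuit v θ).op = (Real.cos θ : ℂ) • 1 +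
      (Complex.I * Real.sin θ) • ancTensor (pauli 3) (pauliString v) := by
  simp only [rotationCircuit, Circuit.op_append, Circuit.op_singleton, Circuit.op_adjoint,
    Layer.op_single_zero, zRotation, ancTensor_add_left, ancTensor_smul_left, ancTensor_one_one]
  have hu := Matrix.mem_unitaryGroup_iff.1 (flipCircuit v (List.finRange q)).op_mem_unitary
  rw [Matrix.star_eq_conjTranspose] at hu
  rw [← flipCircuit_conj_pauli, add_mul, mul_add, smul_mul_assoc, smul_mul_assoc, mul_smul_comm,
    mul_smul_comm, one_mul, hu, mul_assoc]

theorem pauliString_mul_self {q : ℕ} (v : Fin q → Fin 4) : pauliString v * pauliString v = 1 := by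
  rw [pauliString_eq_piTensor, ← map_mul, ← map_one piTensor]
  congr 1
  funext j
  exact pauli_mul_self _

theorem pauliString_conjTranspose {q : ℕ} (v : Fin q → Fin 4) :
    (pauliString v)ᴴ = pauliString v := by
  ext x y
  rw [Matrix.conjTranspose_apply, pauliString_eq_piTensor, piTensor_apply, piTensor_apply,
    star_prod]
  refine Finset.prod_congr rfl fun j _ => ?_
  rw [← Matrix.conjTranspose_apply, pauli_conjTranspose]

/-- The exponential of a multiple of an involution. -/
theorem exp_smul_of_mul_self_eq_one {A : Type*} [NormedRing A] [NormedAlgebra ℂ A]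
    [CompleteSpace A] {P : A} (hP : P * P = 1) (z : ℂ) :
    NormedSpace.exp (z • P) = Complex.cosh z • 1 + Complex.sinh z • P := by
  let _ : NormedAlgebra ℚ A := NormedAlgebra.restrictScalars ℚ ℂ A
  have h1 : ((1 / 2 : ℂ) • (1 + P)) * ((1 / 2 : ℂ) • (1 + P)) = (1 / 2 : ℂ) • (1 + P) := by
    rw [smul_mul_smul_comm, show (1 + P) * (1 + P) = (2 : ℂ) • (1 + P) by
      simp only [add_mul, mul_add, hP, two_smul, one_mul, mul_one]; abel, smul_smul]
    norm_num
  have h2 : ((1 / 2 : ℂ) • (1 - P)) * ((1 / 2 : ℂ) • (1 - P)) = (1 / 2 : ℂ) • (1 - P) := by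
    rw [smul_mul_smul_comm, show (1 - P) * (1 - P) = (2 : ℂ) • (1 - P) by
      simp only [sub_mul, mul_sub, hP, two_smul, one_mul, mul_one]; abel, smul_smul]
    norm_num
  have h3 : ((1 / 2 : ℂ) • (1 + P)) * ((1 / 2 : ℂ) • (1 - P)) = 0 := by
    rw [smul_mul_smul_comm, show (1 + P) * (1 - P) = 0 by
      simp only [add_mul, mul_sub, hP, one_mul, mul_one]; abel, smul_zero]
  have h4 : ((1 / 2 : ℂ) • (1 - P)) * ((1 / 2 : ℂ) • (1 + P)) = 0 := by
    rw [smul_mul_smul_comm, show (1 - P) * (1 + P) = 0 by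
      simp only [sub_mul, mul_add, hP, one_mul, mul_one]; abel, smul_zero]
  -- The complementary idempotents `(1 ± P)/2` embed `ℂ × ℂ`, with `(z, -z)` going to `zP`; the
  -- exponential is then taken componentwise.
  let f : ℂ × ℂ →+* A :=
    { toFun := fun a => a.1 • ((1 / 2 : ℂ) • (1 + P)) + a.2 • ((1 / 2 : ℂ) • (1 - P))
      map_one' := by
        simp only [Prod.fst_one, Prod.snd_one, one_smul, ← smul_add, add_add_sub_cancel]
        rw [← two_smul ℂ (1 : A), smul_smul]; norm_num
      map_zero' := by simp
      map_add' := fun a b => by simp only [Prod.fst_add, Prod.snd_add, add_smul]; abel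
      map_mul' := fun a b => by
        rw [add_mul, mul_add, mul_add]
        simp only [smul_mul_smul_comm _ ((1 / 2 : ℂ) • (1 + P)),
          smul_mul_smul_comm _ ((1 / 2 : ℂ) • (1 - P)), h1, h2, h3, h4]
        simp }
  have hf : Continuous f := by
    change Continuous fun a : ℂ × ℂ =>
      a.1 • ((1 / 2 : ℂ) • (1 + P)) + a.2 • ((1 / 2 : ℂ) • (1 - P))
    fun_prop
  have h := NormedSpace.map_exp f hf (z, -z)
  have hz : f (z, -z) = z • P := by
    change z • ((1 / 2 : ℂ) • (1 + P)) + (-z) • ((1 / 2 : ℂ) • (1 - P)) = z • P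
    module
  rw [← hz, ← h]
  change (NormedSpace.exp (z, -z) : ℂ × ℂ).1 • ((1 / 2 : ℂ) • (1 + P)) +
    (NormedSpace.exp (z, -z) : ℂ × ℂ).2 • ((1 / 2 : ℂ) • (1 - P)) = _
  rw [Prod.fst_exp, Prod.snd_exp, ← Complex.exp_eq_exp_ℂ, Complex.cosh, Complex.sinh]
  module

theorem evolution_pauliTerm {q L : ℕ} (w : Fin L → ℝ) (v : Fin L → Fin q → Fin 4) (l : Fin L)
    (t : ℝ) : evolution (pauliTerm w v l) t = (Real.cos (t * w l) : ℂ) • 1 +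
      (Complex.I * Real.sin (t * w l)) • pauliString (v l) := by
  rw [evolution, pauliTerm, smul_smul, exp_smul_of_mul_self_eq_one (pauliString_mul_self _),
    show Complex.I * t * w l = ((t * w l : ℝ) : ℂ) * Complex.I by push_cast; ring,
    Complex.cosh_mul_I, Complex.sinh_mul_I, Complex.ofReal_cos, Complex.ofReal_sin,
    mul_comm Complex.I]

/-! ### A linear-depth Fourier transform and incrementer -/

/-- `e^{2πir}`. -/
noncomputable def phase (r : ℝ) : ℂ := Complex.exp (2 * Real.pi * Complex.I * r)

@[simp] theorem phase_zero : phase 0 = 1 := by simp [phase]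

theorem phase_add (r s : ℝ) : phase (r + s) = phase r * phase s := by
  rw [phase, phase, phase, ← Complex.exp_add]
  push_cast
  ring_nf

theorem phase_sum {ι : Type*} (s : Finset ι) (f : ι → ℝ) :
    phase (∑ i ∈ s, f i) = ∏ i ∈ s, phase (f i) := by
  simp only [phase, ← Complex.exp_sum, Complex.ofReal_sum, Finset.mul_sum]

theorem phase_natCast (m : ℕ) : phase m = 1 := by
  rw [phase, Complex.exp_eq_one_iff]
  exact ⟨m, by push_cast; ring⟩

theorem phase_mul_star (r : ℝ) : phase r * star (phase r) = 1 := by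
  rw [RCLike.star_def, Complex.mul_conj, Complex.normSq_eq_norm_sq, phase,
    show 2 * (Real.pi : ℂ) * Complex.I * r = ((2 * Real.pi * r : ℝ) : ℂ) * Complex.I by
      push_cast; ring, Complex.norm_exp_ofReal_mul_I]
  simp

/-- The diagonal unitary with entries `e^{2πi f}`. -/
noncomputable def diagonalPhase {ι : Type*} [Fintype ι] [DecidableEq ι] (f : ι → ℝ) :
    Matrix.unitaryGroup ι ℂ :=
  ⟨Matrix.diagonal fun i => phase (f i), by
    rw [Matrix.mem_unitaryGroup_iff, Matrix.star_eq_conjTranspose, Matrix.diagonal_conjTranspose,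
      Matrix.diagonal_mul_diagonal, ← Matrix.diagonal_one]
    congr 1
    funext i
    exact phase_mul_star _⟩

/-- The phase `e^{2πi ab / 2^{k-j+1}}`. -/
noncomputable def pairPhase {n : ℕ} (j k : Fin n) (a b : Fin 2) : ℂ :=
  phase ((a : ℕ) * (b : ℕ) / 2 ^ ((k : ℕ) - j + 1))

/-- The controlled phases between qubits `j < k` with `j + k = t`. -/
noncomputable def phaseGate {n : ℕ} (t : ℕ) (j : Fin n) : Option (Gate n) :=
  -- For `j > t` the truncated difference is `0`, so the first condition fails and no spurious gate
  -- appears.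
  if h : (j : ℕ) < t - j ∧ t - j < n then
    some (.two j ⟨t - j, h.2⟩ (fun e => h.1.ne (congrArg Fin.val e))
      (diagonalPhase fun ab => (ab.1 : ℕ) * (ab.2 : ℕ) / 2 ^ (t - j - j + 1)))
  else none

noncomputable def phaseLayer (n t : ℕ) : Layer n where
  gates := (List.finRange n).filterMap (phaseGate t)
  disjoint := by
    rw [List.pairwise_filterMap]
    refine (List.nodup_finRange n).imp ?_
    intro a b hab g hg g' hg'
    have hab' : (a : ℕ) ≠ b := fun e => hab (Fin.ext e)
    simp only [phaseGate, Option.dite_none_right_eq_some, Option.some.injEq] at hg hg'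
    obtain ⟨h, rfl⟩ := hg
    obtain ⟨h', rfl⟩ := hg'
    simp only [Gate.support, Finset.disjoint_left, Finset.mem_insert, Finset.mem_singleton]
    rintro c (rfl | rfl) (h1 | h1) <;> simp only [Fin.ext_iff] at h1 <;> omega

theorem prod_map_filterMap {α β M : Type*} [Monoid M] (f : α → Option β) (g : β → M)
    (l : List α) : ((l.filterMap f).map g).prod = (l.map fun a => (f a).elim 1 g).prod := by
  induction l with
  | nil => rfl
  | cons a l ih =>
    rw [List.filterMap_cons, List.map_cons, List.prod_cons, ← ih]
    cases f a <;> simp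

theorem op_phaseGate {n : ℕ} (t : ℕ) (j : Fin n) : (phaseGate t j).elim 1 Gate.op =
    Matrix.diagonal fun x => ∏ k, if j < k ∧ (j : ℕ) + k = t then pairPhase j k (x j) (x k)
      else 1 := by
  unfold phaseGate
  split_ifs with h
  · rw [Option.elim_some]
    ext x y
    have hs : (∏ k, if j < k ∧ (j : ℕ) + k = t then pairPhase j k (x j) (x k) else 1) =
        pairPhase j ⟨t - j, h.2⟩ (x j) (x ⟨t - j, h.2⟩) := by
      rw [Finset.prod_eq_single ⟨t - j, h.2⟩]
      · rw [if_pos]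
        exact ⟨h.1, by simp only []; omega⟩
      · intro k _ hk
        rw [if_neg]
        rintro ⟨_, h2⟩
        exact hk (Fin.ext (by simp only []; omega))
      · simp
    simp only [Gate.op, Matrix.of_apply, diagonalPhase, Matrix.diagonal_apply, hs, Prod.mk.injEq]
    by_cases hxy : x = y
    · subst hxy
      simp [pairPhase]
    · rw [if_neg hxy]
      split_ifs with h1 h2
      · refine absurd (funext fun k => ?_) hxy
        by_cases hj : k = j
        · exact hj ▸ h2.1
        · by_cases hk : k = ⟨t - j, h.2⟩
          · exact hk ▸ h2.2
          · exact h1 k hj hk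
      · rfl
      · rfl
  · rw [Option.elim_none, ← Matrix.diagonal_one]
    congr 1
    funext x
    symm
    refine Finset.prod_eq_one fun k _ => if_neg ?_
    rintro ⟨h1, h2⟩
    have := k.2
    rw [Fin.lt_def] at h1
    omega

theorem op_phaseLayer (n t : ℕ) : (phaseLayer n t).op =
    Matrix.diagonal fun x => ∏ j : Fin n, ∏ k : Fin n,
      if j < k ∧ (j : ℕ) + k = t then pairPhase j k (x j) (x k) else 1 := by
  rw [Layer.op, phaseLayer, prod_map_filterMap]
  simp only [op_phaseGate]
  have := map_list_prod (Matrix.diagonalRingHom (Basis n) ℂ) ((List.finRange n).map fun (j : Fin n) x =>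
    ∏ k : Fin n, if j < k ∧ (j : ℕ) + k = t then pairPhase j k (x j) (x k) else 1)
  rw [List.map_map] at this
  refine this.symm.trans ?_
  rw [Matrix.diagonalRingHom_apply]
  congr 1
  funext x
  rw [Pi.list_prod_apply, List.map_map, Fin.prod_univ_def]
  rfl

/-- The Hadamard gate on qubit `t / 2` if `t` is even. -/
noncomputable def hadamardLayer (n t : ℕ) : Layer n :=
  if h : t / 2 < n ∧ Even t then Layer.single ⟨t / 2, h.1⟩ hadamard
  else ⟨[], List.Pairwise.nil⟩

/-- The first `t` steps of the Fourier transform. -/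
noncomputable def fourierCircuit (n : ℕ) : ℕ → Circuit n
  | 0 => []
  | t + 1 => fourierCircuit n t ++ [phaseLayer n t, hadamardLayer n t]

theorem depth_fourierCircuit (n t : ℕ) : (fourierCircuit n t).depth = 2 * t := by
  induction t with
  | zero => rfl
  | succ t ih => simp [fourierCircuit, ih]; ring

/-- Matrix entries of partial Fourier transforms: qubits with `S` are transformed, the pairs
with `T` have interacted. -/
noncomputable def fourierEntry {n : ℕ} (S : Fin n → Prop) (T : Fin n → Fin n → Prop)
    [DecidablePred S] [∀ j k, Decidable (T j k)] (x y : Basis n) : ℂ :=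
  (∏ k, if S k then ((1 / Real.sqrt 2 : ℝ) : ℂ) else if x k = y k then 1 else 0) *
    ∏ j, ∏ k, if T j k then pairPhase j k (x j) (y k) else 1

theorem fourierEntry_congr {n : ℕ} {S S' : Fin n → Prop} {T T' : Fin n → Fin n → Prop}
    [DecidablePred S] [∀ j k, Decidable (T j k)] [DecidablePred S'] [∀ j k, Decidable (T' j k)]
    (hS : ∀ k, S k ↔ S' k) (hT : ∀ j k, T j k ↔ T' j k) (x y : Basis n) :
    fourierEntry S T x y = fourierEntry S' T' x y := by
  simp only [fourierEntry, hS, hT]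

theorem fourierEntry_eq_zero {n : ℕ} {S : Fin n → Prop} {T : Fin n → Fin n → Prop}
    [DecidablePred S] [∀ j k, Decidable (T j k)] {x y : Basis n} {k : Fin n} (hk : ¬ S k)
    (hxy : x k ≠ y k) : fourierEntry S T x y = 0 := by
  rw [fourierEntry, Finset.prod_eq_zero (Finset.mem_univ k), zero_mul]
  rw [if_neg hk, if_neg hxy]

/-- For `j < k` and `j + k = t`, qubit `j` has been transformed and qubit `k` has not. The remaining
Kronecker delta lets `x k` be read as the input bit `y k`; if a delta fails, both sides are zero. -/
theorem phaseLayer_step {n : ℕ} (t : ℕ) (x y : Basis n) :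
    (∏ j : Fin n, ∏ k : Fin n, if j < k ∧ (j : ℕ) + k = t then pairPhase j k (x j) (x k) else 1) *
      fourierEntry (fun k : Fin n => 2 * (k : ℕ) < t) (fun j k => j ≤ k ∧ (j : ℕ) + k < t) x y =
    fourierEntry (fun k : Fin n => 2 * (k : ℕ) < t)
      (fun j k => (j ≤ k ∧ (j : ℕ) + k < t) ∨ (j < k ∧ (j : ℕ) + k = t)) x y := by
  by_cases h : ∀ k : Fin n, ¬ 2 * (k : ℕ) < t → x k = y k
  · rw [fourierEntry, fourierEntry, mul_left_comm]
    congr 1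
    simp only [← Finset.prod_mul_distrib]
    refine Finset.prod_congr rfl fun j _ => Finset.prod_congr rfl fun k _ => ?_
    by_cases h1 : j < k ∧ (j : ℕ) + k = t
    · have h3 : ¬ 2 * (k : ℕ) < t := by
        have := Fin.lt_def.1 h1.1
        omega
      simp [h1, h k h3]
    · simp [h1]
  · push Not at h
    obtain ⟨k, hk, hne⟩ := h
    rw [fourierEntry_eq_zero (by simpa using hk) hne, fourierEntry_eq_zero (by simpa using hk) hne, mul_zero]

/-- This is `pairPhase` for equal indices, so the Hadamard gate completes an antidiagonal with its
pair `(i, i)`. -/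
theorem hadamard_apply (a b : Fin 2) : (hadamard : Matrix (Fin 2) (Fin 2) ℂ) a b =
    ((1 / Real.sqrt 2 : ℝ) : ℂ) * phase ((a : ℕ) * (b : ℕ) / 2) := by
  have h : phase 2⁻¹ = -1 := by
    rw [phase, ← Complex.exp_pi_mul_I]
    congr 1
    push_cast
    ring
  fin_cases a <;> fin_cases b <;> simp [hadamard, h]

/-- Before the gate, qubit `i` still carries `y i`; the gate replaces its delta by `1/√2` and adds
the pair `(i, i)`. No other pair on the antidiagonal `2i` involves `i`. -/
theorem hadamardLayer_step {n : ℕ} (i : Fin n) (x y : Basis n) :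
    (hadamard : Matrix (Fin 2) (Fin 2) ℂ) (x i) (y i) *
      fourierEntry (fun k : Fin n => 2 * (k : ℕ) < 2 * i)
        (fun j k => (j ≤ k ∧ (j : ℕ) + k < 2 * i) ∨ (j < k ∧ (j : ℕ) + k = 2 * i))
        (Function.update x i (y i)) y =
    fourierEntry (fun k : Fin n => 2 * (k : ℕ) < 2 * i + 1)
      (fun j k => j ≤ k ∧ (j : ℕ) + k < 2 * i + 1) x y := by
  rw [hadamard_apply, fourierEntry, fourierEntry, mul_mul_mul_comm]
  congr 1
  · rw [← Finset.mul_prod_erase _ _ (Finset.mem_univ i),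
      ← Finset.mul_prod_erase Finset.univ (fun k : Fin n => if 2 * (k : ℕ) < 2 * i + 1 then _ else _)
        (Finset.mem_univ i)]
    simp only [lt_self_iff_false, if_false, Function.update_self, if_true, one_mul,
      Nat.lt_succ_self]
    congr 1
    refine Finset.prod_congr rfl fun k hk => ?_
    have hk := Finset.ne_of_mem_erase hk
    have : 2 * (k : ℕ) < 2 * i ↔ 2 * (k : ℕ) < 2 * i + 1 := by
      have : (k : ℕ) ≠ i := fun e => hk (Fin.ext e)
      omega
    simp only [this, Function.update_of_ne hk]
  · have hi : phase ((x i : ℕ) * (y i : ℕ) / 2) =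
        ∏ j, ∏ k, if j = i ∧ k = i then pairPhase j k (x j) (y k) else 1 := by
      rw [Finset.prod_eq_single i, Finset.prod_eq_single i]
      · simp [pairPhase]
      · intro k _ hk; simp [hk]
      · simp
      · intro j _ hj; simp [hj]
      · simp
    rw [hi]
    simp only [← Finset.prod_mul_distrib]
    refine Finset.prod_congr rfl fun j _ => Finset.prod_congr rfl fun k _ => ?_
    by_cases hj : j = i
    · subst hj
      by_cases hk : k = j
      · subst hk
        have : (k : ℕ) + k = 2 * k := by ring
        simp [this]
      · have h1 : ¬ ((j ≤ k ∧ (j : ℕ) + k < 2 * j) ∨ (j < k ∧ (j : ℕ) + k = 2 * j)) := by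
          simp only [Fin.le_def, Fin.lt_def]; omega
        have h2 : ¬ (j ≤ k ∧ (j : ℕ) + k < 2 * j + 1) := by
          have : (k : ℕ) ≠ j := fun e => hk (Fin.ext e)
          simp only [Fin.le_def]; omega
        simp only [hk, h1, h2, and_false, if_false, mul_one]
    · have h1 : ((j ≤ k ∧ (j : ℕ) + k < 2 * i) ∨ (j < k ∧ (j : ℕ) + k = 2 * i)) ↔
          (j ≤ k ∧ (j : ℕ) + k < 2 * i + 1) := by
        have : (j : ℕ) ≠ i := fun e => hj (Fin.ext e)
        simp only [Fin.le_def, Fin.lt_def]; omega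
      simp only [hj, false_and, if_false, one_mul, h1, Function.update_of_ne hj]

theorem op_fourierCircuit_apply (n t : ℕ) (x y : Basis n) : (fourierCircuit n t).op x y =
    fourierEntry (fun k : Fin n => 2 * (k : ℕ) < t) (fun j k => j ≤ k ∧ (j : ℕ) + k < t) x y := by
  induction t generalizing x with
  | zero =>
    simp only [fourierCircuit, Circuit.op_nil, fourierEntry, not_lt_zero, and_false, if_false,
      Finset.prod_const_one, mul_one, Finset.prod_ite_zero, Matrix.one_apply, funext_iff,
      Finset.mem_univ, forall_true_left]
  | succ t ih =>
    have hD : ∀ x, ((phaseLayer n t).op * (fourierCircuit n t).op) x y =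
        fourierEntry (fun k : Fin n => 2 * (k : ℕ) < t)
          (fun j k => (j ≤ k ∧ (j : ℕ) + k < t) ∨ (j < k ∧ (j : ℕ) + k = t)) x y := fun x => by
      rw [op_phaseLayer, Matrix.diagonal_mul, ih, phaseLayer_step]
    rw [fourierCircuit, Circuit.op_append, Circuit.op_cons, Circuit.op_singleton, mul_assoc]
    unfold hadamardLayer
    split_ifs with h
    · obtain ⟨m, hm⟩ := h.2
      obtain ⟨i, hi⟩ : ∃ i : Fin n, i = ⟨t / 2, h.1⟩ := ⟨_, rfl⟩
      have hti : t = 2 * i := by rw [hi]; simp only []; omega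
      rw [← hi, Matrix.mul_apply]
      simp only [hD]
      simp only [Layer.op, Layer.single, List.map_cons, List.map_nil, List.prod_singleton, Gate.op,
        Matrix.of_apply, ite_mul, zero_mul]
      rw [sum_agree_off_one, Finset.sum_eq_single (y i)]
      · subst hti
        rw [Function.update_self, hadamardLayer_step]
      · intro b _ hb
        rw [fourierEntry_eq_zero (k := i), mul_zero]
        · simp [hti]
        · simpa using hb
      · simp
    · rw [show Layer.op (⟨[], List.Pairwise.nil⟩ : Layer n) = 1 from rfl, one_mul, hD]
      rw [not_and, Nat.even_iff] at h
      refine fourierEntry_congr (fun k => ?_) (fun j k => ?_) x y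
      · have := k.2
        omega
      · have := k.2
        simp only [Fin.le_def, Fin.lt_def]
        omega

/-! ### The increment as a Fourier multiplier -/

/-- The number with binary digits `y`, the most significant one being `y 0`. -/
def binaryValue {n : ℕ} (y : Basis n) : ℕ := ∑ k, (y k : ℕ) * 2 ^ (n - 1 - k)

/-- Add one modulo `2ⁿ`. -/
def increment : {n : ℕ} → Basis n → Basis n
  | 0, y => y
  | _ + 1, y => Fin.cons (if ∀ i, Fin.tail y i = 1 then y 0 + 1 else y 0) (increment (Fin.tail y))

theorem binaryValue_succ {n : ℕ} (y : Basis (n + 1)) :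
    binaryValue y = (y 0 : ℕ) * 2 ^ n + binaryValue (Fin.tail y) := by
  rw [binaryValue, binaryValue, Fin.sum_univ_succ]
  congr 1
  refine Finset.sum_congr rfl fun k _ => ?_
  rw [Fin.tail, Fin.val_succ]
  congr 2
  omega

theorem binaryValue_increment {n : ℕ} (y : Basis n) :
    binaryValue (increment y) + (if ∀ i, y i = 1 then 2 ^ n else 0) = binaryValue y + 1 := by
  induction n with
  | zero => simp [binaryValue]
  | succ n ih =>
    have h := ih (Fin.tail y)
    rw [binaryValue_succ, binaryValue_succ y, increment, Fin.cons_zero, Fin.tail_cons]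
    have hall : (∀ i, y i = 1) ↔ y 0 = 1 ∧ ∀ i, Fin.tail y i = 1 := Fin.forall_fin_succ
    rw [if_congr hall rfl rfl, pow_succ]
    by_cases ht : ∀ i, Fin.tail y i = 1
    · rw [if_pos ht] at h
      rw [if_pos ht]
      obtain h0 | h0 : y 0 = 0 ∨ y 0 = 1 := by
        generalize y 0 = a
        revert a
        decide
      · simp [h0]; omega
      · rw [if_pos ⟨h0, ht⟩]
        simp [h0]; omega
    · rw [if_neg ht] at h
      rw [if_neg ht, if_neg fun h => ht h.2]
      omega

/-- Pairs with `k < j` are absent from the circuit, but their phases would be integral multiples of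
a full turn. Including them assembles the whole binary value of `y`. -/
theorem op_fourierCircuit_eq (n : ℕ) (x y : Basis n) : (fourierCircuit n (2 * n)).op x y =
    ((1 / Real.sqrt 2 : ℝ) : ℂ) ^ n * ∏ j, phase ((x j : ℕ) * binaryValue y / 2 ^ (n - (j : ℕ))) := by
  rw [op_fourierCircuit_apply, fourierEntry]
  congr 1
  · rw [← Fin.prod_const]
    refine Finset.prod_congr rfl fun k _ => if_pos ?_
    have := k.2
    omega
  · refine Finset.prod_congr rfl fun j _ => ?_
    have : ((x j : ℕ) * binaryValue y / 2 ^ (n - (j : ℕ)) : ℝ) =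
        ∑ k : Fin n,
          ((x j : ℕ) * ((y k : ℕ) * 2 ^ (n - 1 - (k : ℕ))) / 2 ^ (n - (j : ℕ)) : ℝ) := by
      rw [binaryValue, ← Finset.sum_div, ← Finset.mul_sum]
      push_cast
      rfl
    rw [this, phase_sum]
    refine Finset.prod_congr rfl fun k _ => ?_
    have hj := j.2
    have hk := k.2
    by_cases hjk : j ≤ k
    · rw [if_pos ⟨hjk, by omega⟩, pairPhase]
      rw [Fin.le_def] at hjk
      congr 1
      rw [show n - (j : ℕ) = (n - 1 - k) + (k - j + 1) by omega, pow_add]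
      field_simp
      ring
    · rw [if_neg fun h => hjk h.1]
      rw [Fin.le_def] at hjk
      have h2 : ((x j : ℕ) * ((y k : ℕ) * 2 ^ (n - 1 - (k : ℕ))) / 2 ^ (n - (j : ℕ)) : ℝ) =
          ((x j : ℕ) * ((y k : ℕ) * 2 ^ (j - k - 1 : ℕ)) : ℕ) := by
        rw [show n - 1 - (k : ℕ) = (n - j) + (j - k - 1) by omega, pow_add]
        push_cast
        field_simp
      rw [h2, phase_natCast]

/-- The permutation matrix of `increment`. -/
def incrementOp (n : ℕ) : Op n := Matrix.of fun x y => if x = increment y then 1 else 0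

/-- Phase gates whose conjugation by the Fourier transform is the increment. -/
noncomputable def incrementPhase {n : ℕ} (j : Fin n) : Matrix.unitaryGroup (Fin 2) ℂ :=
  diagonalPhase fun a => (a : ℕ) / 2 ^ (n - (j : ℕ))

noncomputable def incrementPhaseLayer (n : ℕ) : Layer n where
  gates := (List.finRange n).map fun j => Gate.one j (incrementPhase j)
  disjoint := by
    rw [List.pairwise_map]
    refine (List.nodup_finRange n).imp ?_
    intro a b hab
    simpa [Gate.support] using hab

theorem op_incrementPhaseLayer (n : ℕ) : (incrementPhaseLayer n).op =
    Matrix.diagonal fun x => ∏ j : Fin n, phase ((x j : ℕ) / 2 ^ (n - (j : ℕ))) := by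
  have h : (incrementPhaseLayer n).op =
      piTensor fun j => (incrementPhase j : Matrix (Fin 2) (Fin 2) ℂ) := by
    rw [← list_prod_mulSingle fun j => (incrementPhase j : Matrix (Fin 2) (Fin 2) ℂ),
      map_list_prod, List.map_map, Layer.op, incrementPhaseLayer, List.map_map]
    congr 2
    funext j
    exact Gate.op_one _ _
  rw [h]
  ext x y
  simp only [piTensor_apply, incrementPhase, diagonalPhase, Matrix.diagonal_apply,
    Finset.prod_ite_zero, Finset.mem_univ, forall_true_left, funext_iff]

/-- Adding one to `y` multiplies row `x` by `∏ⱼ e^{2πi xⱼ / 2^{n-j}}`. The wrap-around by `2ⁿ`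
contributes the integers `xⱼ 2ʲ` and hence no phase. -/
theorem incrementPhaseLayer_mul_fourier (n : ℕ) :
    (incrementPhaseLayer n).op * (fourierCircuit n (2 * n)).op =
      (fourierCircuit n (2 * n)).op * incrementOp n := by
  ext x y
  rw [op_incrementPhaseLayer, Matrix.diagonal_mul, Matrix.mul_apply]
  simp only [incrementOp, Matrix.of_apply, mul_ite, mul_one, mul_zero, Finset.sum_ite_eq',
    Finset.mem_univ, if_true]
  rw [op_fourierCircuit_eq, op_fourierCircuit_eq, mul_left_comm, ← Finset.prod_mul_distrib]
  congr 1
  refine Finset.prod_congr rfl fun j _ => ?_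
  have hv : (binaryValue (increment y) : ℝ) + ((if ∀ i, y i = 1 then 2 ^ n else 0 : ℕ) : ℝ) =
      binaryValue y + 1 := by exact_mod_cast binaryValue_increment y
  rw [← phase_add]
  have h1 : ((x j : ℕ) / 2 ^ (n - (j : ℕ)) + (x j : ℕ) * binaryValue y / 2 ^ (n - (j : ℕ)) : ℝ) =
      (x j : ℕ) * binaryValue (increment y) / 2 ^ (n - (j : ℕ)) +
        ((x j : ℕ) * (if ∀ i, y i = 1 then 2 ^ (j : ℕ) else 0) : ℕ) := by
    have h2 : (((if ∀ i, y i = 1 then 2 ^ n else 0 : ℕ) : ℝ)) =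
        ((if ∀ i, y i = 1 then 2 ^ (j : ℕ) else 0 : ℕ) : ℝ) * 2 ^ (n - (j : ℕ)) := by
      split_ifs
      · push_cast
        rw [← pow_add]
        congr 1
        have := j.2
        omega
      · simp
    rw [h2] at hv
    push_cast at hv ⊢
    field_simp
    linear_combination (-(x j : ℕ) : ℝ) * hv
  rw [h1, phase_add, phase_natCast, mul_one]

noncomputable def incrementCircuit (n : ℕ) : Circuit n :=
  fourierCircuit n (2 * n) ++ [incrementPhaseLayer n] ++ (fourierCircuit n (2 * n)).adjoint

theorem op_incrementCircuit (n : ℕ) : (incrementCircuit n).op = incrementOp n := by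
  simp only [incrementCircuit, Circuit.op_append, Circuit.op_singleton, Circuit.op_adjoint]
  rw [incrementPhaseLayer_mul_fourier, ← mul_assoc, Circuit.conjTranspose_mul_op, one_mul]

theorem depth_incrementCircuit (n : ℕ) : (incrementCircuit n).depth = 8 * n + 1 := by
  simp [incrementCircuit, depth_fourierCircuit]
  ring

/-! ### The multi-controlled `Z` gate in linear depth -/

/-- The projection onto `|1…1⟩`. -/
def onesProj (n : ℕ) : Op n := Matrix.diagonal fun x => if ∀ i, x i = 1 then 1 else 0

/-- The carry into the leading bit occurs exactly when the old tail is all ones. Thus the full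
increment is a multi-controlled `X` followed by the increment of the tail. -/
theorem incrementOp_succ (n : ℕ) : incrementOp (n + 1) = ancTensor 1 (incrementOp n) *
    (ancTensor (pauliX : Matrix (Fin 2) (Fin 2) ℂ) (onesProj n) +
      ancTensor 1 (1 - onesProj n)) := by
  rw [mul_add, ancTensor_mul, ancTensor_mul, one_mul, one_mul]
  ext x y
  have hX : ∀ a b : Fin 2, (pauliX : Matrix (Fin 2) (Fin 2) ℂ) a b = if a = b + 1 then 1 else 0 := by
    intro a b
    fin_cases a <;> fin_cases b <;> simp [pauliX]
  have hP : ∀ u v : Basis n, (1 - onesProj n : Op n) u v =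
      (Matrix.diagonal fun x : Basis n => if ∀ i, x i = 1 then (0 : ℂ) else 1) u v := by
    intro u v
    rw [onesProj, ← Matrix.diagonal_one, Matrix.diagonal_sub]
    congr 2
    funext x
    split_ifs <;> simp
  rw [Matrix.ext hP]
  simp only [ancTensor, onesProj, Matrix.add_apply, Matrix.of_apply, Matrix.mul_diagonal, hX,
    Matrix.one_apply, incrementOp, basis_succ_ext (x := x), increment, Fin.cons_zero, Fin.tail_cons]
  by_cases ht : ∀ i, Fin.tail y i = 1
  · simp only [if_pos ht]
    split_ifs <;> simp_all
  · simp only [if_neg ht]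
    split_ifs <;> simp_all

theorem multiControlledZ_succ (n : ℕ) : multiControlledZ (n + 1) =
    ancTensor (pauli 3) (onesProj n) + ancTensor 1 (1 - onesProj n) := by
  ext x y
  have hall : (∀ i, x i = 1) ↔ x 0 = 1 ∧ ∀ i, Fin.tail x i = 1 := Fin.forall_fin_succ
  simp only [multiControlledZ, ancTensor, onesProj, Matrix.add_apply, Matrix.of_apply,
    Matrix.diagonal_apply, Matrix.one_apply, Matrix.sub_apply, basis_succ_ext (x := x), hall]
  generalize Fin.tail x = u, Fin.tail y = w
  generalize x 0 = a, y 0 = b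
  by_cases hu : u = w
  · subst hu
    by_cases ho : ∀ i, u i = 1 <;> fin_cases a <;> fin_cases b <;> simp [ho, pauli]
  · simp [hu]

theorem hadamard_conj_pauliX : (hadamard : Matrix (Fin 2) (Fin 2) ℂ) * pauliX * hadamard =
    pauli 3 := by
  have h : ((Real.sqrt 2 : ℝ) : ℂ)⁻¹ * ((Real.sqrt 2 : ℝ) : ℂ)⁻¹ = 1 / 2 := by
    rw [← mul_inv, ← Complex.ofReal_mul, Real.mul_self_sqrt (by norm_num)]; norm_num
  ext i j
  fin_cases i <;> fin_cases j <;>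
    simp [hadamard, pauliX, pauli, Matrix.mul_apply, Fin.sum_univ_two, h] <;> norm_num

theorem hadamard_mul_self : (hadamard : Matrix (Fin 2) (Fin 2) ℂ) * hadamard = 1 := by
  have := Matrix.mem_unitaryGroup_iff.1 hadamard.2
  rwa [Matrix.star_eq_conjTranspose, hadamard_conjTranspose] at this

/-- A multi-controlled `Z` on `q + 1` qubits, by incrementing all qubits and decrementing the
last `q`. -/
noncomputable def mczCircuit (q : ℕ) : Circuit (q + 1) :=
  [Layer.single 0 hadamard] ++ incrementCircuit (q + 1) ++ (incrementCircuit q).onSystem.adjoint ++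
    [Layer.single 0 hadamard]

theorem depth_mczCircuit (q : ℕ) : (mczCircuit q).depth = 16 * q + 12 := by
  simp [mczCircuit, depth_incrementCircuit]
  ring

theorem op_mczCircuit (q : ℕ) : (mczCircuit q).op = multiControlledZ (q + 1) := by
  have hu := (incrementCircuit q).onSystem.conjTranspose_mul_op
  rw [Circuit.op_onSystem, op_incrementCircuit] at hu
  simp only [mczCircuit, Circuit.op_append, Circuit.op_singleton, Circuit.op_adjoint,
    Circuit.op_onSystem, op_incrementCircuit, Layer.op_single_zero]
  rw [incrementOp_succ, ← mul_assoc (ancTensor 1 (incrementOp q))ᴴ,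
    ← mul_assoc (ancTensor 1 (incrementOp q))ᴴ, hu, one_mul, ← mul_assoc, mul_add, add_mul,
    multiControlledZ_succ]
  simp only [ancTensor_mul, one_mul, mul_one, hadamard_conj_pauliX, hadamard_mul_self]

/-! ### Circuits for the controlled product formula -/

/-- `∑ₖ |k⟩⟨k| ⊗ W k`. -/
def blockDiag {q : ℕ} : (Fin 2 → Op q) →* Op (q + 1) where
  toFun W := Matrix.of fun x y =>
    if x 0 = y 0 then W (x 0) (Fin.tail x) (Fin.tail y) else 0
  map_one' := by
    ext x y
    simp only [Matrix.of_apply, Pi.one_apply, Matrix.one_apply, basis_succ_ext (x := x), ite_and]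
  map_mul' W W' := by
    ext x y
    simp only [Matrix.mul_apply, Matrix.of_apply, sum_basis_succ, Fin.cons_zero, Fin.tail_cons,
      Pi.mul_apply]
    rw [Finset.sum_eq_single (x 0) (fun b _ hb => by simp [hb.symm]) (by simp)]
    simp only [if_true, mul_ite, mul_zero]
    split_ifs <;> simp

theorem blockDiag_apply {q : ℕ} (W : Fin 2 → Op q) (x y : Basis (q + 1)) :
    blockDiag W x y = if x 0 = y 0 then W (x 0) (Fin.tail x) (Fin.tail y) else 0 := rfl

/-- The gate `diag(1, i)`. -/
noncomputable def phaseS : Matrix.unitaryGroup (Fin 2) ℂ := diagonalPhase fun k => (k : ℕ) / 4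

theorem phaseS_apply (a b : Fin 2) : (phaseS : Matrix (Fin 2) (Fin 2) ℂ) a b =
    if a = b then Complex.I ^ (a : ℕ) else 0 := by
  have h : phase 4⁻¹ = Complex.I := by
    rw [phase, show 2 * (Real.pi : ℂ) * Complex.I * ((4⁻¹ : ℝ) : ℂ) = Real.pi / 2 * Complex.I by
      push_cast; ring, Complex.exp_pi_div_two_mul_I]
  fin_cases a <;> fin_cases b <;> simp [phaseS, diagonalPhase, h]

/-- The factors `iᵏ` split off as one gate on the ancilla. The rest is multiplicative in `W`, so
both branches are compiled together. -/
theorem controlled_eq {q : ℕ} (W : Fin 2 → Op q) :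
    controlled W = (Layer.single 0 phaseS).op * blockDiag W := by
  rw [Layer.op_single_zero]
  ext x y
  rw [Matrix.mul_apply]
  simp only [sum_basis_succ, blockDiag_apply, controlled, ancTensor, Matrix.of_apply,
    phaseS_apply, Fin.cons_zero, Fin.tail_cons, Matrix.one_apply, Matrix.sum_apply,
    Matrix.smul_apply, Matrix.single_apply, smul_eq_mul]
  generalize x 0 = a, y 0 = b
  fin_cases a <;> fin_cases b <;> simp [Fin.sum_univ_two]

/-- The ancilla `Z` has eigenvalue `(-1)ᵏ` on `|k⟩`, which supplies the sign of time without a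
controlled gate. -/
theorem blockDiag_evolution_pauliTerm {q L : ℕ} (w : Fin L → ℝ) (v : Fin L → Fin q → Fin 4)
    (l : Fin L) (t : ℝ) :
    blockDiag (fun k => evolution (pauliTerm w v l) ((-1) ^ (k : ℕ) * t)) =
      (rotationCircuit (v l) (t * w l)).op := by
  rw [op_rotationCircuit]
  ext x y
  simp only [blockDiag_apply, evolution_pauliTerm, Matrix.add_apply, Matrix.smul_apply, ancTensor,
    Matrix.of_apply, smul_eq_mul, Matrix.one_apply, basis_succ_ext (x := x)]
  generalize x 0 = a, y 0 = b
  fin_cases a <;> fin_cases b <;> simp [pauli]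

theorem exists_circuit_list_prod {n D : ℕ} {α : Type*} (f : α → Op n) (s : List α)
    (h : ∀ a ∈ s, ∃ c : Circuit n, c.op = f a ∧ c.depth ≤ D) :
    ∃ c : Circuit n, c.op = (s.map f).prod ∧ c.depth ≤ s.length * D := by
  induction s with
  | nil => exact ⟨[], rfl, by simp⟩
  | cons a s ih =>
    obtain ⟨c, hc, hd⟩ := ih fun b hb => h b (List.mem_cons_of_mem _ hb)
    obtain ⟨c', hc', hd'⟩ := h a List.mem_cons_self
    refine ⟨c ++ c', ?_, ?_⟩
    · rw [Circuit.op_append, hc, hc', List.map_cons, List.prod_cons]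
    · rw [Circuit.depth_append, List.length_cons, Nat.succ_mul]
      omega

theorem evolution_mul {q : ℕ} (H : Op q) (c t : ℝ) :
    NormedSpace.exp (((c : ℂ) * (Complex.I * t)) • H) = evolution H (c * t) := by
  rw [evolution]
  congr 2
  push_cast
  ring

theorem suzuki_eq_productFormula {q L : ℕ} (h : Fin L → Op q) (κ : ℕ) (t : ℝ) :
    suzuki h κ t = productFormula h (suzukiSchedule L κ) (Complex.I * t) := by
  induction κ using Nat.twoStepInduction generalizing t with
  | zero => rfl
  | one =>
    simp only [suzuki, strang, suzukiSchedule, productFormula, List.map_append, List.map_reverse,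
      List.prod_append, List.map_ofFn, Function.comp_def, evolution_mul, one_div_mul_eq_div]
  | more k _ ih =>
    rw [productFormula_suzuki_succ]
    change suzuki h (k + 1) (suzukiCoeff k * t) ^ 2 *
      suzuki h (k + 1) ((1 - 4 * suzukiCoeff k) * t) *
        suzuki h (k + 1) (suzukiCoeff k * t) ^ 2 = _
    rw [ih, ih, Complex.ofReal_mul, Complex.ofReal_mul, mul_left_comm, mul_left_comm Complex.I]

/-- One rotation of depth `2q + 1` per exponential, at most `2L·5^κ` exponentials per step, `ν`
steps, and one layer for the factors `iᵏ`. -/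
theorem exists_circuit_controlledTrotter {q L : ℕ} (w : Fin L → ℝ) (v : Fin L → Fin q → Fin 4)
    (κ ν : ℕ) (ω : ℝ) : ∃ U : Circuit (q + 1),
      U.op = controlledTrotter (pauliTerm w v) κ ν ω ∧
        U.depth ≤ ν * (2 * L * 5 ^ κ * (2 * q + 1)) + 1 := by
  obtain ⟨c, hc, hd⟩ := exists_circuit_list_prod (D := 2 * q + 1)
    (fun c : ℝ × Fin L => blockDiag fun k : Fin 2 =>
      evolution (pauliTerm w v c.2) ((-1) ^ (k : ℕ) * (c.1 * (ω / ν)))) (suzukiSchedule L κ)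
    fun c _ => ⟨_, (blockDiag_evolution_pauliTerm w v c.2 _).symm, (depth_rotationCircuit _ _).le⟩
  obtain ⟨c', hc', hd'⟩ := exists_circuit_list_prod (D := 2 * L * 5 ^ κ * (2 * q + 1))
    (fun _ : Unit => c.op) (List.replicate ν ()) fun _ _ => ⟨c, rfl, hd.trans
      (Nat.mul_le_mul_right _ (length_suzukiSchedule_le L κ))⟩
  refine ⟨c' ++ [Layer.single 0 phaseS], ?_, ?_⟩
  · rw [Circuit.op_append, Circuit.op_singleton, controlledTrotter, controlled_eq, hc',
      List.map_replicate, List.prod_replicate, hc]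
    have := map_list_prod (blockDiag (q := q)) ((suzukiSchedule L κ).map
      fun (c : ℝ × Fin L) (k : Fin 2) =>
        evolution (pauliTerm w v c.2) ((-1) ^ (k : ℕ) * (c.1 * (ω / ν))))
    rw [List.map_map] at this
    rw [show (fun c : ℝ × Fin L => blockDiag fun k : Fin 2 =>
      evolution (pauliTerm w v c.2) ((-1) ^ (k : ℕ) * (c.1 * (ω / ν)))) = blockDiag ∘
      fun (c : ℝ × Fin L) (k : Fin 2) =>
        evolution (pauliTerm w v c.2) ((-1) ^ (k : ℕ) * (c.1 * (ω / ν))) from rfl, ← this,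
      ← map_pow]
    congr 2
    funext k
    rw [trotter, suzuki_eq_productFormula, productFormula, Pi.pow_apply, Pi.list_prod_apply,
      List.map_map]
    congr 3
    funext c
    simp only [Function.comp, evolution_mul]
    congr 1
    ring
  · rw [Circuit.depth_append, Circuit.depth_cons, Circuit.depth_nil]
    simpa using hd'

/-! ### Norm bounds -/

/-- Homomorphisms of C⋆-algebras that preserve the star are contractive. -/
theorem ancTensor_one_norm_le {q : ℕ} (N : Op q) : ‖ancTensor 1 N‖ ≤ ‖N‖ := by
  let φ : Op q →⋆ₙₐ[ℂ] Op (q + 1) :=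
    { toFun := ancTensor 1
      map_smul' := fun c N => ancTensor_smul_right c 1 N
      map_zero' := by ext x y; simp [ancTensor]
      map_add' := ancTensor_add_right 1
      map_mul' := fun N N' => by rw [ancTensor_mul, one_mul]
      map_star' := fun N => by
        rw [Matrix.star_eq_conjTranspose, Matrix.star_eq_conjTranspose, ancTensor_conjTranspose,
          Matrix.conjTranspose_one] }
  exact NonUnitalStarAlgHom.norm_apply_le φ N

theorem ancTensor_single_norm_le {q : ℕ} (k : Fin 2) (N : Op q) :
    ‖ancTensor (Matrix.single k k 1) N‖ ≤ ‖N‖ := by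
  have h : ancTensor (Matrix.single k k 1) N =
      Matrix.diagonal (fun x : Basis (q + 1) => if x 0 = k then 1 else 0) * ancTensor 1 N := by
    ext x y
    simp only [Matrix.diagonal_mul, ancTensor, Matrix.of_apply, Matrix.single_apply,
      Matrix.one_apply]
    split_ifs <;> simp_all
  rw [h]
  refine (norm_mul_le _ _).trans ?_
  have hd : ‖(Matrix.diagonal (fun x : Basis (q + 1) => if x 0 = k then 1 else 0) : Op (q + 1))‖ ≤
      1 := by
    rw [Matrix.l2_opNorm_diagonal, pi_norm_le_iff_of_nonneg zero_le_one]
    intro x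
    split_ifs <;> simp
  calc _ ≤ 1 * ‖N‖ := mul_le_mul hd (ancTensor_one_norm_le N) (norm_nonneg _) zero_le_one
    _ = ‖N‖ := one_mul _

theorem norm_controlled_sub_le {q : ℕ} (W W' : Fin 2 → Op q) :
    ‖controlled W - controlled W'‖ ≤ ‖W 0 - W' 0‖ + ‖W 1 - W' 1‖ := by
  rw [controlled, controlled, ← Finset.sum_sub_distrib, Fin.sum_univ_two]
  simp only [← smul_sub, ← ancTensor_sub_right]
  refine (norm_add_le _ _).trans (add_le_add ?_ ?_)
  · rw [norm_smul]
    simpa using ancTensor_single_norm_le 0 (W 0 - W' 0)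
  · rw [norm_smul]
    simpa using ancTensor_single_norm_le 1 (W 1 - W' 1)

theorem norm_apply_le {n : ℕ} (M : Op n) (x y : Basis n) : ‖M x y‖ ≤ ‖M‖ := by
  have h := Matrix.l2_opNorm_mulVec M (EuclideanSpace.single y (1 : ℂ))
  rw [PiLp.norm_single, norm_one, mul_one] at h
  refine le_trans ?_ h
  have h2 := PiLp.norm_apply_le ((EuclideanSpace.equiv (Basis n) ℂ).symm
    (M *ᵥ (EuclideanSpace.single y (1 : ℂ)).ofLp)) x
  simpa using h2

theorem norm_trace_le {n : ℕ} (M : Op n) : ‖M.trace‖ ≤ 2 ^ n * ‖M‖ := by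
  refine (norm_sum_le_of_le _ fun x _ => norm_apply_le M x x).trans ?_
  simp

theorem trace_piTensor {n : ℕ} (M : Fin n → Matrix (Fin 2) (Fin 2) ℂ) :
    (piTensor M).trace = ∏ j, (M j).trace := by
  simp only [Matrix.trace, Matrix.diag_apply, piTensor_apply]
  rw [Finset.prod_univ_sum]
  simp

theorem trace_pauli_mul (a b : Fin 4) : (pauli a * pauli b).trace = if a = b then 2 else 0 := by
  fin_cases a <;> fin_cases b <;>
    simp [pauli, Matrix.trace, Fin.sum_univ_two] <;> norm_num

theorem trace_pauliString_mul {q : ℕ} (v v' : Fin q → Fin 4) :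
    (pauliString v * pauliString v').trace = if v = v' then 2 ^ q else 0 := by
  rw [pauliString_eq_piTensor, pauliString_eq_piTensor, ← map_mul, trace_piTensor]
  simp only [Pi.mul_apply, trace_pauli_mul, Finset.prod_ite_zero, funext_iff]
  simp

theorem pauliString_mem_unitary {q : ℕ} (v : Fin q → Fin 4) : pauliString v ∈ unitary (Op q) := by
  refine Matrix.mem_unitaryGroup_iff.2 ?_
  rw [Matrix.star_eq_conjTranspose, pauliString_conjTranspose, pauliString_mul_self]

theorem IsNormalized.norm_le_one {q : ℕ} {H : Op q} (hH : IsNormalized H) : ‖H‖ ≤ 1 := by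
  have hs : IsSelfAdjoint H := hH.1
  rw [← hs.toReal_spectralRadius_eq_norm]
  refine ENNReal.toReal_le_of_le_ofReal zero_le_one ?_
  refine iSup₂_le fun μ hμ => ?_
  obtain ⟨h0, h1⟩ := hH.2 μ hμ
  rw [ENNReal.ofReal_one]
  have : ‖μ‖₊ ≤ 1 := by
    rw [← NNReal.coe_le_coe, coe_nnnorm, Real.norm_eq_abs, abs_of_pos h0]
    exact h1
  exact_mod_cast this

/-- Distinct Pauli strings are orthogonal for the trace, so `w_l 2^q = tr(P_l H)`. The trace is at
most `2^q` times the norm, and `‖P_l H‖ ≤ ‖H‖ ≤ 1`. -/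
theorem norm_pauliTerm_le_one {q L : ℕ} {w : Fin L → ℝ} {v : Fin L → Fin q → Fin 4}
    (hv : Function.Injective v) (hH : IsNormalized (∑ l, pauliTerm w v l)) (l : Fin L) :
    ‖pauliTerm w v l‖ ≤ 1 := by
  have htr : (pauliString (v l) * ∑ m, pauliTerm w v m).trace = (w l : ℂ) * 2 ^ q := by
    rw [Finset.mul_sum, Matrix.trace_sum]
    simp only [pauliTerm, Matrix.mul_smul, Matrix.trace_smul, trace_pauliString_mul, hv.eq_iff,
      smul_eq_mul, mul_ite, mul_zero, Finset.sum_ite_eq, Finset.mem_univ, if_true]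
  have hP : ‖pauliString (v l)‖ = 1 := CStarRing.norm_of_mem_unitary (pauliString_mem_unitary _)
  have hb := norm_trace_le (pauliString (v l) * ∑ m, pauliTerm w v m)
  have hm : ‖pauliString (v l) * ∑ m, pauliTerm w v m‖ ≤ 1 := by
    refine (norm_mul_le _ _).trans ?_
    rw [hP, one_mul]
    exact hH.norm_le_one
  rw [htr, norm_mul, norm_pow, Complex.norm_ofNat, mul_comm] at hb
  rw [pauliTerm, norm_smul, hP, mul_one]
  have hpos : (0 : ℝ) < 2 ^ q := by positivity
  exact (le_of_mul_le_mul_left hb hpos).trans hm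

/-! ### Accumulated Trotter error and the number of steps -/

theorem evolution_mem_unitary {q : ℕ} {H : Op q} (hH : H.IsHermitian) (t : ℝ) :
    evolution H t ∈ unitary (Op q) := by
  let _ : NormedAlgebra ℚ (Op q) := NormedAlgebra.restrictScalars ℚ ℂ (Op q)
  refine NormedSpace.exp_mem_unitary_of_mem_skewAdjoint ?_
  rw [skewAdjoint.mem_iff, star_smul, Matrix.star_eq_conjTranspose, hH.eq, ← neg_smul]
  congr 1
  simp

theorem evolution_div_pow {q : ℕ} (H : Op q) {ν : ℕ} (hν : 1 ≤ ν) (t : ℝ) :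
    evolution H (t / ν) ^ ν = evolution H t := by
  let _ : NormedAlgebra ℚ (Op q) := NormedAlgebra.restrictScalars ℚ ℂ (Op q)
  rw [evolution, evolution, ← NormedSpace.exp_nsmul, ← Nat.cast_smul_eq_nsmul ℂ, smul_smul]
  congr 2
  have : (ν : ℂ) ≠ 0 := by exact_mod_cast (by omega : ν ≠ 0)
  push_cast
  field_simp

theorem pauliTerm_isHermitian {q L : ℕ} (w : Fin L → ℝ) (v : Fin L → Fin q → Fin 4) (l : Fin L) :
    (pauliTerm w v l).IsHermitian := by
  rw [Matrix.IsHermitian, pauliTerm, Matrix.conjTranspose_smul, pauliString_conjTranspose]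
  simp

theorem suzuki_mem_unitary {q L : ℕ} {h : Fin L → Op q} (hh : ∀ l, (h l).IsHermitian) (κ : ℕ)
    (t : ℝ) : suzuki h κ t ∈ unitary (Op q) := by
  rw [suzuki_eq_productFormula]
  refine Submonoid.list_prod_mem _ ?_
  simp only [List.mem_map]
  rintro _ ⟨c, _, rfl⟩
  rw [evolution_mul]
  exact evolution_mem_unitary (hh _) _

theorem norm_pow_sub_pow_le {A : Type*} [NormedRing A] [NormOneClass A] {x y : A} (hx : ‖x‖ ≤ 1)
    (hy : ‖y‖ ≤ 1) (n : ℕ) : ‖x ^ n - y ^ n‖ ≤ n * ‖x - y‖ := by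
  induction n with
  | zero => simp
  | succ n ih =>
    have h : x ^ (n + 1) - y ^ (n + 1) = x ^ n * (x - y) + (x ^ n - y ^ n) * y := by
      rw [pow_succ, pow_succ]; noncomm_ring
    rw [h]
    refine (norm_add_le _ _).trans ?_
    have h1 : ‖x ^ n * (x - y)‖ ≤ 1 * ‖x - y‖ := (norm_mul_le _ _).trans
      (by gcongr; exact (norm_pow_le x n).trans (pow_le_one₀ (norm_nonneg _) hx))
    have h2 : ‖(x ^ n - y ^ n) * y‖ ≤ n * ‖x - y‖ * 1 := (norm_mul_le _ _).trans (by gcongr)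
    push_cast
    linarith

theorem norm_trotter_sub_le {q L : ℕ} {w : Fin L → ℝ} {v : Fin L → Fin q → Fin 4}
    (hv : Function.Injective v) (hH : IsNormalized (∑ l, pauliTerm w v l)) {κ ν : ℕ} (hκ : 1 ≤ κ)
    (hν : 1 ≤ ν) {B t : ℝ} (hB : 0 < B) (hL : 2 * (L : ℝ) * 5 ^ κ ≤ B) (ht : B * |t| ≤ ν) :
    ‖trotter (pauliTerm w v) κ ν t - evolution (∑ l, pauliTerm w v l) t‖ ≤
      6 * (B * |t|) ^ (2 * κ + 1) / ν ^ (2 * κ) := by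
  have hν0 : (0 : ℝ) < ν := by exact_mod_cast hν
  have hn : ‖Complex.I * ((t / ν : ℝ) : ℂ)‖ = |t| / ν := by
    rw [norm_mul, Complex.norm_I, one_mul, Complex.norm_real, Real.norm_eq_abs, abs_div,
      abs_of_pos hν0]
  have h1 := norm_productFormula_suzuki_sub_le (pauliTerm w v) (norm_pauliTerm_le_one hv hH) hκ hB
    hL (z := Complex.I * ((t / ν : ℝ) : ℂ)) (by
      rw [hn, ← mul_div_assoc, div_le_one hν0]; exact ht)
  rw [← suzuki_eq_productFormula, hn] at h1
  rw [trotter, ← evolution_div_pow _ hν t]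
  have hsum : (∑ l, pauliTerm w v l).IsHermitian := hH.1
  refine (norm_pow_sub_pow_le
    (CStarRing.norm_of_mem_unitary (suzuki_mem_unitary (pauliTerm_isHermitian w v) κ _)).le
    (CStarRing.norm_of_mem_unitary (evolution_mem_unitary hsum _)).le ν).trans ?_
  calc (ν : ℝ) * ‖suzuki (pauliTerm w v) κ (t / ν) - evolution (∑ l, pauliTerm w v l) (t / ν)‖
      ≤ ν * (6 * (B * (|t| / ν)) ^ (2 * κ + 1)) := mul_le_mul_of_nonneg_left h1 hν0.le
    _ = 6 * (B * |t|) ^ (2 * κ + 1) / ν ^ (2 * κ) := by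
      rw [← mul_div_assoc, div_pow, pow_succ (ν : ℝ)]
      field_simp

/-- The number of steps for precision `ε`. -/
theorem exists_steps {κ : ℕ} (hκ : 1 ≤ κ) {b : ℕ} (hb : 1 ≤ b) {ε : ℝ} (hε : 0 < ε)
    (hε1 : ε ≤ 1) : ∃ ν : ℕ, 1 ≤ ν ∧ b ≤ ν ∧
      6 * (b : ℝ) ^ (2 * κ + 1) / ν ^ (2 * κ) ≤ ε / 2 ∧
      (ν : ℝ) ≤ 24 * b ^ 2 * ε ^ (-(1 / (2 * (κ : ℝ)))) := by
  set E : ℝ := ε ^ (-(1 / (2 * (κ : ℝ)))) with hE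
  have hκ0 : (0 : ℝ) < κ := by exact_mod_cast hκ
  have hE1 : 1 ≤ E := Real.one_le_rpow_of_pos_of_le_one_of_nonpos hε hε1 (by
    rw [Left.neg_nonpos_iff]; positivity)
  have hEp : E ^ (2 * κ) = ε⁻¹ := by
    rw [hE, ← Real.rpow_natCast, ← Real.rpow_mul hε.le, ← Real.rpow_neg_one]
    congr 1
    push_cast
    field_simp
  have hb1 : (1 : ℝ) ≤ b := by exact_mod_cast hb
  have hbb : (b : ℝ) ≤ b ^ 2 := by nlinarith
  have hNE : 12 * (b : ℝ) ^ 2 ≤ 12 * b ^ 2 * E := le_mul_of_one_le_right (by positivity) hE1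
  have hlow : 12 * (b : ℝ) ^ 2 * E ≤ ⌈12 * (b : ℝ) ^ 2 * E⌉₊ := Nat.le_ceil _
  have hup : (⌈12 * (b : ℝ) ^ 2 * E⌉₊ : ℝ) < 12 * (b : ℝ) ^ 2 * E + 1 :=
    Nat.ceil_lt_add_one (by positivity)
  -- Since `E^{2κ} = 1/ε`, the factor `E` produces the precision. The square of `b` avoids a
  -- fractional power, because `b^{2κ+1} ≤ b^{4κ}`; rounding up at most doubles the value, whence
  -- `24`.
  refine ⟨⌈12 * (b : ℝ) ^ 2 * E⌉₊, ?_, ?_, ?_, ?_⟩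
  · have : (1 : ℝ) ≤ ⌈12 * (b : ℝ) ^ 2 * E⌉₊ := by linarith
    exact_mod_cast this
  · have : (b : ℝ) ≤ ⌈12 * (b : ℝ) ^ 2 * E⌉₊ := by linarith
    exact_mod_cast this
  · rw [div_le_iff₀ (by
      have : (0 : ℝ) < ⌈12 * (b : ℝ) ^ 2 * E⌉₊ := by linarith
      positivity)]
    have h1 : (12 * (b : ℝ) ^ 2 * E) ^ (2 * κ) ≤ (⌈12 * (b : ℝ) ^ 2 * E⌉₊ : ℝ) ^ (2 * κ) := by
      gcongr
    have h2 : 12 * (b : ℝ) ^ (2 * κ + 1) ≤ (12 * (b : ℝ) ^ 2) ^ (2 * κ) := by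
      rw [mul_pow, ← pow_mul]
      gcongr
      · exact le_self_pow₀ (by norm_num) (by omega)
      · omega
    have h3 : ε / 2 * (12 * (b : ℝ) ^ 2 * E) ^ (2 * κ) = (12 * (b : ℝ) ^ 2) ^ (2 * κ) / 2 := by
      rw [mul_pow _ E, hEp]
      field_simp
    calc 6 * (b : ℝ) ^ (2 * κ + 1) ≤ (12 * (b : ℝ) ^ 2) ^ (2 * κ) / 2 := by linarith
      _ = ε / 2 * (12 * (b : ℝ) ^ 2 * E) ^ (2 * κ) := h3.symm
      _ ≤ _ := by gcongr
  · linarith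

theorem exists_simulation (κ : ℕ) (hκ : 1 ≤ κ) (ω : ℝ) (terms : Polynomial ℕ) :
    ∃ P : Polynomial ℕ, ∀ q : ℕ, 1 ≤ q → ∀ (L : ℕ) (w : Fin L → ℝ) (v : Fin L → Fin q → Fin 4),
      L ≤ terms.eval q → Function.Injective v → IsNormalized (∑ l, pauliTerm w v l) →
      ∀ ε : ℝ, 0 < ε → ε ≤ 1 → ∃ (ν : ℕ) (U : Circuit (q + 1)), 1 ≤ ν ∧
        U.op = controlledTrotter (pauliTerm w v) κ ν ω ∧
        ‖trotter (pauliTerm w v) κ ν (-ω) - evolution (∑ l, pauliTerm w v l) (-ω)‖ ≤ ε ∧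
        ‖U.op - controlledEvolution (∑ l, pauliTerm w v l) ω‖ ≤ ε ∧
        (U.depth : ℝ) ≤ ((P.eval q : ℕ) : ℝ) * ε ^ (-(1 / (2 * (κ : ℝ)))) := by
  set K : ℕ := ⌈|ω|⌉₊ + 1 with hK
  set Q : Polynomial ℕ := Polynomial.C (2 * 5 ^ κ) * (terms + 1) with hQ
  -- The first factors are the bound on `ν` with `b = BK`, where `B = Q(q)`; the remaining one is
  -- the depth of a step. The final `1` is the ancilla phase gate, absorbed because the power of `ε`
  -- is at least `1`.
  refine ⟨24 * (Q * Polynomial.C K) ^ 2 * (Q * (2 * Polynomial.X + 1)) + 1, ?_⟩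
  intro q _ L w v hL hv hH ε hε hε1
  set B : ℕ := 2 * 5 ^ κ * (terms.eval q + 1) with hB
  have hB1 : 1 ≤ B := Nat.one_le_iff_ne_zero.2 (by positivity)
  have hK1 : 1 ≤ K := by omega
  have hωK : |ω| ≤ K := by
    rw [hK]; push_cast
    exact (Nat.le_ceil _).trans (by linarith)
  have hLB : 2 * L * 5 ^ κ ≤ B := by
    rw [hB]
    calc 2 * L * 5 ^ κ = 2 * 5 ^ κ * L := by ring
      _ ≤ _ := Nat.mul_le_mul_left _ (by omega)
  obtain ⟨ν, hν1, hbν, herr, hνle⟩ := exists_steps hκ (b := B * K)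
    (Nat.one_le_iff_ne_zero.2 (by positivity)) hε hε1
  obtain ⟨U, hU, hdepth⟩ := exists_circuit_controlledTrotter w v κ ν ω
  have hBω : (B : ℝ) * |ω| ≤ ((B * K : ℕ) : ℝ) := by
    push_cast
    gcongr
  -- One `ν` serves both signs of time. The error `ε/2` per branch leaves `ε` for the sum of the two
  -- block errors.
  have hmain : ∀ t : ℝ, |t| = |ω| →
      ‖trotter (pauliTerm w v) κ ν t - evolution (∑ l, pauliTerm w v l) t‖ ≤ ε / 2 := by
    intro t ht
    refine (norm_trotter_sub_le hv hH hκ hν1 (B := B) (by exact_mod_cast hB1)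
      (by exact_mod_cast hLB) ?_).trans (le_trans ?_ herr)
    · rw [ht]
      exact hBω.trans (by exact_mod_cast hbν)
    · rw [ht]
      gcongr
  refine ⟨ν, U, hν1, hU, (hmain (-ω) (abs_neg ω)).trans (by linarith), ?_, ?_⟩
  · rw [hU]
    refine (norm_controlled_sub_le _ _).trans ?_
    have h0 := hmain ((-1) ^ ((0 : Fin 2) : ℕ) * ω) (by simp)
    have h1 := hmain ((-1) ^ ((1 : Fin 2) : ℕ) * ω) (by simp)
    linarith
  · have hE1 : 1 ≤ ε ^ (-(1 / (2 * (κ : ℝ)))) :=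
      Real.one_le_rpow_of_pos_of_le_one_of_nonpos hε hε1 (by
        rw [Left.neg_nonpos_iff]; positivity)
    have hev : (24 * (Q * Polynomial.C K) ^ 2 * (Q * (2 * Polynomial.X + 1)) + 1 : Polynomial ℕ).eval q =
        24 * (B * K) ^ 2 * (B * (2 * q + 1)) + 1 := by
      simp [hQ, hB]
    rw [hev]
    have hd : (U.depth : ℝ) ≤ ν * (B * (2 * q + 1)) + 1 := by
      have : U.depth ≤ ν * (B * (2 * q + 1)) + 1 := hdepth.trans (by gcongr)
      exact_mod_cast this
    have h2 : (ν : ℝ) * (B * (2 * q + 1)) ≤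
        24 * ((B * K : ℕ) : ℝ) ^ 2 * ε ^ (-(1 / (2 * (κ : ℝ)))) * (B * (2 * q + 1)) := by
      gcongr
    push_cast at h2 ⊢
    linarith

end QAAE

/-! ### Assembly of the depth bounds -/

theorem proposition2 :
    ∃ (mcz : ∀ q : ℕ, QAAE.Circuit (q + 1)) (C C' : ℕ),
      -- a multi-controlled `Z` on the `q + 1` qubits in depth `O(q)`
      (∀ q : ℕ, 1 ≤ q →
        (mcz q).op = QAAE.multiControlledZ (q + 1) ∧ (mcz q).depth ≤ C * q) ∧
      -- the reflection, in depth `D_R ≤ 2 D_A + O(q)`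
      (∀ q : ℕ, 1 ≤ q → ∀ A : QAAE.Circuit q,
        (QAAE.reflectionCircuit A (mcz q)).op = QAAE.householder (QAAE.trialState A) ∧
        (QAAE.reflectionCircuit A (mcz q)).depth ≤ 2 * A.depth + C * q) ∧
      -- one round with any circuits for the reflection and for the (simulated) evolution:
      -- `D_round ≤ D_A + 2 (D_R + D_U)`
      (∀ q : ℕ, 1 ≤ q → ∀ (A : QAAE.Circuit q) (R U : QAAE.Circuit (q + 1)),
        R.op = QAAE.householder (QAAE.trialState A) →
        (QAAE.roundCircuit A R U).op *ᵥ QAAE.plusTensor (QAAE.ketZero q) =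
          (QAAE.householder (QAAE.trialState A) * U.op *
            QAAE.householder (QAAE.trialState A) * U.opᴴ) *ᵥ QAAE.trialState A ∧
        (QAAE.roundCircuit A R U).depth ≤ A.depth + 2 * (R.depth + U.depth)) ∧
      -- consequently `D_round ≤ 5 D_A + 2 D_U + O(q)`
      (∀ q : ℕ, 1 ≤ q → ∀ (A : QAAE.Circuit q) (U : QAAE.Circuit (q + 1)),
        (QAAE.roundCircuit A (QAAE.reflectionCircuit A (mcz q)) U).depth ≤
          5 * A.depth + 2 * U.depth + C' * q) ∧
      -- the controlled evolution by a product formula of order `2κ`: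
      -- `D_U = O(poly(q) ε^{-1/(2κ)})` for Hamiltonians with `poly(q)` Pauli terms
      (∀ (κ : ℕ), 1 ≤ κ → ∀ (ω : ℝ) (terms : Polynomial ℕ), ∃ P : Polynomial ℕ,
        ∀ q : ℕ, 1 ≤ q → ∀ (L : ℕ) (w : Fin L → ℝ) (v : Fin L → Fin q → Fin 4),
          L ≤ terms.eval q → Function.Injective v →
          QAAE.IsNormalized (∑ l, QAAE.pauliTerm w v l) →
          ∀ ε : ℝ, 0 < ε → ε ≤ 1 →
            ∃ (ν : ℕ) (U : QAAE.Circuit (q + 1)), 1 ≤ ν ∧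
              U.op = QAAE.controlledTrotter (QAAE.pauliTerm w v) κ ν ω ∧
              ‖QAAE.trotter (QAAE.pauliTerm w v) κ ν (-ω) -
                QAAE.evolution (∑ l, QAAE.pauliTerm w v l) (-ω)‖ ≤ ε ∧
              ‖U.op - QAAE.controlledEvolution (∑ l, QAAE.pauliTerm w v l) ω‖ ≤ ε ∧
              (U.depth : ℝ) ≤ ((P.eval q : ℕ) : ℝ) * ε ^ (-(1 / (2 * (κ : ℝ))))) := by
  -- The reflection costs `2 D_A + 16q + 16`, and `16q + 16 ≤ 32q` for `q ≥ 1`. Two reflections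
  -- contribute `32q + 32 ≤ 64q` to a round, so `72` is not sharp.
  refine ⟨QAAE.mczCircuit, 32, 72, fun q hq => ⟨QAAE.op_mczCircuit q, ?_⟩,
    fun q hq A => ⟨QAAE.op_reflectionCircuit A (QAAE.op_mczCircuit q), ?_⟩,
    fun q _ A R U hR => ⟨?_, (QAAE.depth_roundCircuit A R U).le⟩, fun q hq A U => ?_,
    QAAE.exists_simulation⟩
  · rw [QAAE.depth_mczCircuit]
    omega
  · rw [QAAE.depth_reflectionCircuit, QAAE.depth_mczCircuit]
    omega
  · rw [QAAE.op_roundCircuit_mulVec, hR]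
  · rw [QAAE.depth_roundCircuit, QAAE.depth_reflectionCircuit, QAAE.depth_mczCircuit]
    omega
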